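/- **Setting.** Let $p$ be a prime, $q=p^a$, and let $f\in\mathbf F_q[x_1,\dots,x_n]$ have degree $d$ and homogeneous component $f^{(d)}$ of degree $d$. Inside the completion $\mathbf C_p$ of an algebraic closure of $\mathbf Q_p$, with $\mathrm{ord}$ normalized by $\mathrm{ord}\,p=1$, let $K$ be the unramified extension of $\mathbf Q_p$ of degree $a$ (residue field $\mathbf F_q$), $\tau$ its Frobenius automorphism, $\zeta_p$ a primitive $p$-th root of unity, and $\gamma\in\mathbf Q_p(\zeta_p)$ with $\sum_{i\ge0}\gamma^{p^i}/p^i=0$ and $\mathrm{ord}\,\gamma=1/(p-1)$; put $\gamma_l=\sum_{i=0}^{l}\gamma^{p^i}/p^i$. Let $b$ be a rational number with $\frac1{p-1}<b<\frac p{p-1}$, let $M$ be a positive integer such that $Mb/p$ and $Md/(p-1)$ are integers, let $\pi\in\mathbf C_p$ satisfy $\pi^{Md}=p$, and put $\tilde\Omega_0=K(\zeta_p,\pi)$, with ring of integers $\mathcal O$, and $\epsilon=Mb(d-1)-Md/(p-1)\in\mathbf Z$. Define $$C(b)=\Bigl\{\sum_{u\in\mathbf N^n}A_u\pi^{Mb|u|}x^u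 \;\Big|\; A_u\in\tilde\Omega_0,\ A_u\to0\text{ as }u\to\infty\Bigr\},$$ and, for $r\in\mathbf Z$, let $F^rC(b)$ be the set of those elements of $C(b)$ with $A_u\in\pi^r\mathcal O$ for all $u$. Let $\Omega^k_{C(b)}=\bigoplus_{i_1<\dots<i_k}C(b)\,dx_{i_1}\wedge\dots\wedge dx_{i_k}$ and $F^r\Omega^k_{C(b)}=\bigoplus_{i_1<\dots<i_k}F^rC(b)\,dx_{i_1}\wedge\dots\wedge dx_{i_k}$. Let $\hat f\in K[x_1,\dots,x_n]$ be the Teichmüller lifting of $f$ (its coefficients satisfy $\hat a^q=\hat a$, and it reduces to $f$ modulo $p$), let $\hat f_i=\partial\hat f/\partial x_i$, and let $$D_i=\frac{\partial}{\partial x_i}+\sum_{l\ge0}\gamma_lp^lx_i^{p^l-1}\hat f_i^{\tau^l}(x_1^{p^l},\dots,x_n^{p^l}),\qquad D(\xi\,dx_{i_1}\wedge\dots\wedge dx_{i_k})=\Bigl(\sum_{i=1}^nD_i(\xi)\,dx_i\Bigr)\wedge dx_{i_1}\wedge\dots\wedge dx_{i_k}.$$ **Proposition.** Suppose that $\partial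 f^{(d)}/\partial x_1,\dots,\partial f^{(d)}/\partial x_n$ form a regular sequence in $\mathbf F_q[x_1,\dots,x_n]$. Let $x^{\mu_i}$, $i=1,\dots,(d-1)^n$, be monomials such that the classes $[x^{\mu_i}\,dx_1\wedge\dots\wedge dx_n]$ form an $\mathbf F_q$-basis of the $n$-th cohomology of the complex $(\Omega^{\cdot}_{\mathbf F_q[x_1,\dots,x_n]/\mathbf F_q},\ \omega\mapsto df^{(d)}\wedge\omega)$. Let $r\in\mathbf Z$ and $\eta\in F^r\Omega^n_{C(b)}$. Then there exist $c_i\in\tilde\Omega_0$, $i=1,\dots,(d-1)^n$, such that $c_ix^{\mu_i}\in F^rC(b)$ for every $i$ and, in $H^n(\Omega^{\cdot}_{C(b)},\pi^{\epsilon}D)$, $$[\eta]=\sum_{i=1}^{(d-1)^n}[c_ix^{\mu_i}\,dx_1\wedge\dots\wedge dx_n].$$ -/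

import Mathlib

noncomputable section

namespace DworkAffine

/-! ### Koszul / de Rham type complexes

`M` is a module of coefficients.  A differential form in the `n` variables `x_0, …, x_{n-1}` with
coefficients in `M` is written `ω = ∑_S ω(S) dx_S`, where `S` runs over the subsets of the index set
and `dx_S` is the wedge of the `dx_i`, `i ∈ S`, in increasing order of `i`. -/

section Koszul

variable {R M : Type*} [CommRing R] [AddCommGroup M] [Module R M] {n : ℕ}

/-- The operator `ω ↦ (∑_i δ_i dx_i) ∧ ω`, i.e. `ξ dx_S ↦ ∑_i δ_i(ξ) dx_i ∧ dx_S`.  For `i ∈ T` the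
form `dx_i ∧ dx_{T ∖ i}` equals `(-1)^{#{j ∈ T, j < i}} dx_T`. -/
def wedgeD (δ : Fin n → M →ₗ[R] M) : (Finset (Fin n) → M) →ₗ[R] (Finset (Fin n) → M) :=
  LinearMap.pi fun T => ∑ i ∈ T,
    ((-1 : ℤ) ^ (T.filter (· < i)).card) • ((δ i).comp (LinearMap.proj (T.erase i)))

/-- The forms of degree `k` whose coefficients lie in the submodule `N`. -/
def kForms (n : ℕ) (N : Submodule R M) (k : ℤ) : Submodule R (Finset (Fin n) → M) where
  carrier := {ω | ∀ S, ω S ∈ N ∧ ((S.card : ℤ) ≠ k → ω S = 0)}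
  add_mem' {ω ω'} h h' S := ⟨N.add_mem (h S).1 (h' S).1, fun hS => by
    simp [(h S).2 hS, (h' S).2 hS]⟩
  zero_mem' S := ⟨N.zero_mem, fun _ => rfl⟩
  smul_mem' c ω h S := ⟨N.smul_mem c (h S).1, fun hS => by simp [(h S).2 hS]⟩

/-- Cocycles of degree `k` of the complex of forms with coefficients in `N`. -/
def cocycles (δ : Fin n → M →ₗ[R] M) (N : Submodule R M) (k : ℤ) :
    Submodule R (Finset (Fin n) → M) :=
  kForms n N k ⊓ LinearMap.ker (wedgeD δ)

/-- Coboundaries of degree `k`: images of the forms of degree `k - 1` with coefficients in `N`. -/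
def coboundaries (δ : Fin n → M →ₗ[R] M) (N : Submodule R M) (k : ℤ) :
    Submodule R (Finset (Fin n) → M) :=
  (kForms n N (k - 1)).map (wedgeD δ)

/-- The cohomology `H^k` of the complex of forms with coefficients in `N`. -/
abbrev Cohomology (δ : Fin n → M →ₗ[R] M) (N : Submodule R M) (k : ℤ) : Type _ :=
  cocycles δ N k ⧸ (coboundaries δ N k).submoduleOf (cocycles δ N k)

/-- Every form of top degree `n` is a cocycle. -/
theorem kForms_top_le_cocycles (δ : Fin n → M →ₗ[R] M) (N : Submodule R M) :
    kForms n N n ≤ cocycles δ N n := by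
  intro ω hω
  refine ⟨hω, LinearMap.mem_ker.mpr ?_⟩
  funext T
  simp only [wedgeD, LinearMap.pi_apply, LinearMap.sum_apply, LinearMap.smul_apply,
    LinearMap.comp_apply, LinearMap.proj_apply, Pi.zero_apply]
  refine Finset.sum_eq_zero fun i hi => ?_
  have h : ω (T.erase i) = 0 := by
    apply (hω _).2
    have h1 := Finset.card_erase_lt_of_mem hi
    have h2 : T.card ≤ n := by simpa using T.card_le_univ
    omega
  simp [h]

/-- The cohomology class `[η]` in `H^n` of a form `η` of top degree. -/
def topClass (δ : Fin n → M →ₗ[R] M) (N : Submodule R M) :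
    kForms n N n →ₗ[R] Cohomology δ N n :=
  (Submodule.mkQ _).comp (Submodule.inclusion (kForms_top_le_cocycles δ N))

/-- The form `ξ dx_0 ∧ ⋯ ∧ dx_{n-1}`, for `ξ` in `N`. -/
def topForm (N : Submodule R M) (ξ : M) (hξ : ξ ∈ N) : kForms n N n :=
  ⟨fun S => if S = Finset.univ then ξ else 0, fun S => by
    by_cases h : S = Finset.univ
    · simp [h, hξ]
    · simp [h]⟩

end Koszul

/-! ### The `p`-adic fields

All fields are subfields of `ℂ_[p]`, the completion of an algebraic closure of `ℚ_[p]`, whose norm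
is normalized by `‖p‖ = 1 / p`; thus `ord x = - log_p ‖x‖`. -/

section Fields

variable (p : ℕ) [Fact p.Prime]

/-- The unramified extension `K` of `ℚ_p` of degree `a` (for `a ≥ 1`), generated by the roots of
`x ^ q = x` with `q = p ^ a`. -/
def unramified (a : ℕ) : IntermediateField ℚ_[p] ℂ_[p] :=
  IntermediateField.adjoin ℚ_[p] {x | x ^ p ^ a = x}

/-- The field `K(ζ, π)`. -/
def bigField (a : ℕ) (ζ π : ℂ_[p]) : IntermediateField ℚ_[p] ℂ_[p] :=
  unramified p a ⊔ IntermediateField.adjoin ℚ_[p] {ζ, π}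

variable {p}

/-- The ring of integers of a subfield `L` of `ℂ_p`. -/
def integers (L : IntermediateField ℚ_[p] ℂ_[p]) : Subring L where
  carrier := {x | ‖(x : ℂ_[p])‖ ≤ 1}
  mul_mem' {x y} hx hy := by
    have : ‖(x : ℂ_[p])‖ * ‖(y : ℂ_[p])‖ ≤ 1 := mul_le_one₀ hx (norm_nonneg _) hy
    simpa using this
  one_mem' := by simp
  add_mem' {x y} hx hy := by
    have : ‖(x : ℂ_[p]) + y‖ ≤ 1 :=
      (IsUltrametricDist.norm_add_le_max _ _).trans (max_le hx hy)
    simpa using this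
  zero_mem' := by simp
  neg_mem' {x} hx := by simpa using hx

end Fields

/-! ### Lifting the polynomial, and the operators `D_i` -/

section Operators

variable {p : ℕ} [Fact p.Prime] {a n : ℕ}

/-- `fhat` is the Teichmüller lifting of `f`: its coefficients satisfy `â ^ q = â`, and it reduces
to `f` under the reduction map `ρ` from the integers of `K` to the field of `q = p ^ a` elements. -/
structure IsTeichmullerLift {Fq : Type*} [Field Fq]
    (ρ : integers (unramified p a) →+* Fq) (f : MvPolynomial (Fin n) Fq)
    (fhat : MvPolynomial (Fin n) (unramified p a)) : Prop where
  pow_eq : ∀ u, fhat.coeff u ^ p ^ a = fhat.coeff u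
  reduces : ∀ u, ∃ x : integers (unramified p a), (x : unramified p a) = fhat.coeff u ∧
    ρ x = f.coeff u

/-- `γ_l = ∑_{i=0}^l γ^{p^i} / p^i`. -/
def gammaPartial (γ : ℂ_[p]) (l : ℕ) : ℂ_[p] :=
  ∑ i ∈ Finset.range (l + 1), γ ^ p ^ i / (p : ℂ_[p]) ^ i

/-- The polynomial `γ_l p^l x_i^{p^l - 1} f̂_i^{τ^l}(x^{p^l})`, where `f̂_i = ∂f̂/∂x_i`. -/
def hTerm (γ : ℂ_[p]) (τ : unramified p a ≃ₐ[ℚ_[p]] unramified p a)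
    (fhat : MvPolynomial (Fin n) (unramified p a)) (i : Fin n) (l : ℕ) :
    MvPolynomial (Fin n) ℂ_[p] :=
  MvPolynomial.C (gammaPartial γ l * (p : ℂ_[p]) ^ l) * MvPolynomial.X i ^ (p ^ l - 1) *
    MvPolynomial.expand (p ^ l) (MvPolynomial.map (algebraMap (unramified p a) ℂ_[p])
      (MvPolynomial.map ((τ ^ l : unramified p a ≃ₐ[ℚ_[p]] unramified p a) :
        unramified p a →+* unramified p a) (MvPolynomial.pderiv i fhat)))

/-- The power series `H_i = ∑_{l ≥ 0} γ_l p^l x_i^{p^l - 1} f̂_i^{τ^l}(x^{p^l})`, summed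
coefficientwise (each monomial occurs in finitely many terms only). -/
def hSeries (γ : ℂ_[p]) (τ : unramified p a ≃ₐ[ℚ_[p]] unramified p a)
    (fhat : MvPolynomial (Fin n) (unramified p a)) (i : Fin n) : MvPowerSeries (Fin n) ℂ_[p] :=
  fun v => ∑' l : ℕ, (hTerm γ τ fhat i l).coeff v

/-- The operator `D_i = ∂/∂x_i + H_i`. -/
def dOp (γ : ℂ_[p]) (τ : unramified p a ≃ₐ[ℚ_[p]] unramified p a)
    (fhat : MvPolynomial (Fin n) (unramified p a)) (i : Fin n) :
    MvPowerSeries (Fin n) ℂ_[p] →ₗ[ℂ_[p]] MvPowerSeries (Fin n) ℂ_[p] :=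
  (MvPowerSeries.pderiv ℂ_[p] i).toLinearMap + LinearMap.mulLeft ℂ_[p] (hSeries γ τ fhat i)

/-- The operator `π^ε D_i`, as a linear map over the subfield `L`. -/
def scaledD (L : IntermediateField ℚ_[p] ℂ_[p]) (π : ℂ_[p]) (ε : ℤ)
    (γ : ℂ_[p]) (τ : unramified p a ≃ₐ[ℚ_[p]] unramified p a)
    (fhat : MvPolynomial (Fin n) (unramified p a)) (i : Fin n) :
    MvPowerSeries (Fin n) ℂ_[p] →ₗ[L] MvPowerSeries (Fin n) ℂ_[p] :=
  (π ^ ε • dOp γ τ fhat i).restrictScalars L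

end Operators

/-! ### The space `C(b)` and its filtration -/

section Spaces

variable {p : ℕ} [Fact p.Prime]

/-- The space `C(b)` over the field `L`: the series `∑_u A_u π^{e|u|} x^u` with `A_u ∈ L` and
`A_u → 0` as `u → ∞`.  The natural number `e` stands for `M b`. -/
def spaceC (n : ℕ) (L : IntermediateField ℚ_[p] ℂ_[p]) (π : ℂ_[p]) (e : ℕ) :
    Submodule L (MvPowerSeries (Fin n) ℂ_[p]) where
  carrier := {ξ | ∃ A : (Fin n →₀ ℕ) → ℂ_[p], (∀ u, A u ∈ L) ∧
    Filter.Tendsto A Filter.cofinite (nhds 0) ∧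
    ∀ u, MvPowerSeries.coeff u ξ = A u * π ^ (e * u.degree)}
  add_mem' := by
    rintro ξ ξ' ⟨A, hA, hA0, h⟩ ⟨A', hA', hA0', h'⟩
    refine ⟨fun u => A u + A' u, fun u => L.add_mem (hA u) (hA' u), ?_, fun u => ?_⟩
    · simpa using hA0.add hA0'
    · rw [map_add, h, h', add_mul]
  zero_mem' := ⟨fun _ => 0, fun _ => L.zero_mem, tendsto_const_nhds, fun u => by simp⟩
  smul_mem' := by
    rintro c ξ ⟨A, hA, hA0, h⟩
    refine ⟨fun u => (c : ℂ_[p]) * A u, fun u => L.mul_mem c.2 (hA u), ?_, fun u => ?_⟩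
    · simpa using hA0.const_mul (c : ℂ_[p])
    · have : MvPowerSeries.coeff u (c • ξ) = (c : ℂ_[p]) * MvPowerSeries.coeff u ξ := rfl
      rw [this, h, mul_assoc]

/-- The filtration step `F^r C(b)`: the elements `∑_u A_u π^{e|u|} x^u` of `C(b)` such that
`A_u ∈ π^r 𝒪_L` for all `u`. -/
def filC (n : ℕ) (L : IntermediateField ℚ_[p] ℂ_[p]) (π : ℂ_[p]) (e : ℕ) (r : ℤ) :
    Set (MvPowerSeries (Fin n) ℂ_[p]) :=
  {ξ | ξ ∈ spaceC n L π e ∧ ∀ u, ∃ o : integers L,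
    MvPowerSeries.coeff u ξ = π ^ r * ((o : L) : ℂ_[p]) * π ^ (e * u.degree)}

/-- The filtration step `F^r Ω^k_{C(b)}`: the `k`-forms all of whose coefficients lie in
`F^r C(b)`. -/
def filForms (n : ℕ) (L : IntermediateField ℚ_[p] ℂ_[p]) (π : ℂ_[p]) (e : ℕ) (r k : ℤ) :
    Set (kForms n (spaceC n L π e) k) :=
  {η | ∀ S, η.1 S ∈ filC n L π e r}

end Spaces

end DworkAffine

end

/-! Measure a series by the supremum of `‖ξ_u‖ / R^|u|` with `R = ‖π^e‖`. Then `C(b)` is a Banach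
space over the complete field `K(ζ, π)`, and `F^r C(b)` is its closed ball of radius `‖π‖^r`.
Rescaling by nonzero constants does not change images, so `π^ε D_i` may be replaced by `γ⁻¹ D_i =
γ⁻¹ ∂_i + γ⁻¹ H_i`. In this norm it is a small perturbation of multiplication by `G_i`, the part of
degree `d - 1` of `∂f̂/∂x_i`: the lower bound on `b` makes `γ⁻¹ ∂_i` small, and the upper bound
makes `γ⁻¹ H_i - G_i` small (`norm_coeff_sub_leadingPart_le`).

Over `F_q`, each monomial `x^u` is a combination of the `x^{μ_j}` plus multiples of the
`∂f^{(d)}/∂x_i`. Lift the coefficients to Teichmüller representatives and keep only the terms of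
degree `|u|`; the error then has norm at most `‖p‖ ≤ ‖π‖` (`norm_coeff_lift_le`). Extending linearly
gives an operator `N` whose values are combinations of the `x^{μ_j}` plus images of the `γ⁻¹ D_i`,
and `ξ - N ξ` is smaller than `ξ` by a factor `‖π‖`. The contraction principle
(`exists_eq_add_apply_of_contracting`) solves `S = η + (S - N S)`, that is `N S = η`, with `S` no
larger than `η`; this size control places each `c_j x^{μ_j}` in `F^r` (`exists_reduction`). -/

noncomputable section

namespace DworkAffine

/-! ### Top-degree cohomology as a cokernel -/

section Koszul

variable {R M : Type*} [CommRing R] [AddCommGroup M] [Module R M] {n : ℕ}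

theorem wedgeD_apply (δ : Fin n → M →ₗ[R] M) (ω : Finset (Fin n) → M) (T : Finset (Fin n)) :
    wedgeD δ ω T = ∑ i ∈ T, ((-1 : ℤ) ^ (T.filter (· < i)).card) • δ i (ω (T.erase i)) := by
  simp [wedgeD, LinearMap.sum_apply]

/-- A form of degree `n - 1` is a family indexed by the omitted index, and the signs in the
differential can be absorbed into that family. -/
theorem topClass_eq_zero_iff (δ : Fin n → M →ₗ[R] M) (N : Submodule R M) (η : kForms n N n) :
    topClass δ N η = 0 ↔
      ∃ ω : Fin n → M, (∀ i, ω i ∈ N) ∧ η.1 Finset.univ = ∑ i, δ i (ω i) := by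
  have hzero : topClass δ N η = 0 ↔ η.1 ∈ coboundaries δ N n := by
    change Submodule.Quotient.mk (p := (coboundaries δ N n).submoduleOf (cocycles δ N n))
      (Submodule.inclusion (kForms_top_le_cocycles δ N) η) = 0 ↔ _
    rw [Submodule.Quotient.mk_eq_zero]
    rfl
  rw [hzero]
  constructor
  · rintro ⟨ω, hω, h⟩
    refine ⟨fun i => ((-1 : ℤ) ^ ((Finset.univ : Finset (Fin n)).filter (· < i)).card) •
      ω (Finset.univ.erase i), fun i => N.toAddSubgroup.zsmul_mem (hω _).1 _, ?_⟩
    rw [← h, wedgeD_apply]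
    exact Finset.sum_congr rfl fun i _ => (map_zsmul (δ i) _ _).symm
  · rintro ⟨ω, hω, h⟩
    -- When `T` omits exactly one index, the sum over `Tᶜ` has that single term. The sign is its own
    -- inverse and cancels the one in `wedgeD`.
    refine ⟨fun T => if T.card + 1 = n then
      ∑ i ∈ Tᶜ, ((-1 : ℤ) ^ ((Finset.univ : Finset (Fin n)).filter (· < i)).card) • ω i else 0,
      fun T => ?_, ?_⟩
    · dsimp only
      split_ifs with hT
      · exact ⟨N.sum_mem fun i _ => N.toAddSubgroup.zsmul_mem (hω i) _, fun h' => by omega⟩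
      · exact ⟨N.zero_mem, fun _ => rfl⟩
    · funext T
      rw [wedgeD_apply]
      by_cases hT : T = Finset.univ
      · subst hT
        rw [h]
        refine Finset.sum_congr rfl fun i _ => ?_
        have hc : (Finset.univ.erase i : Finset (Fin n)).card + 1 = n := by
          rw [Finset.card_erase_add_one (Finset.mem_univ i), Finset.card_univ, Fintype.card_fin]
        have hcompl : (Finset.univ.erase i : Finset (Fin n))ᶜ = {i} := by ext; simp
        rw [if_pos hc, hcompl, Finset.sum_singleton, map_zsmul, smul_smul, ← mul_pow]
        simp
      · have hlt : T.card < n := by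
          simpa using Finset.card_lt_card (Finset.ssubset_univ_iff.mpr hT)
        rw [(η.2 T).2 (by omega)]
        refine Finset.sum_eq_zero fun i hi => ?_
        have := Finset.card_erase_add_one hi
        rw [if_neg (by omega), map_zero, smul_zero]

end Koszul

/-! ### Weighted sup norms on power series and the contraction principle -/

section WeightedSeries

open MvPowerSeries

variable {F : Type*} [NormedField F] {n : ℕ}

/-- The series `ξ` satisfies `‖ξ_u‖ ≤ B R^{|u|}` for all `u`. -/
def CoeffBound (R B : ℝ) (ξ : MvPowerSeries (Fin n) F) : Prop :=
  ∀ u, ‖coeff u ξ‖ ≤ B * R ^ u.degree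

/-- The series `ξ` satisfies `‖ξ_u‖ / R^{|u|} → 0` as `u → ∞`. -/
def CoeffNull (R : ℝ) (ξ : MvPowerSeries (Fin n) F) : Prop :=
  ∀ ε > 0, ∃ N : ℕ, ∀ u : Fin n →₀ ℕ, N ≤ u.degree → ‖coeff u ξ‖ ≤ ε * R ^ u.degree

/-- The exponents of total degree `N`. -/
def degreeFinset (n N : ℕ) : Finset (Fin n →₀ ℕ) := Finset.finsuppAntidiag Finset.univ N

@[simp]
theorem mem_degreeFinset {N : ℕ} {u : Fin n →₀ ℕ} : u ∈ degreeFinset n N ↔ u.degree = N := by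
  simp [degreeFinset, Finset.mem_finsuppAntidiag, Finsupp.degree_eq_sum]

theorem finite_degree_lt (n N : ℕ) : {u : Fin n →₀ ℕ | u.degree < N}.Finite := by
  refine ((Finset.range N).biUnion (degreeFinset n)).finite_toSet.subset fun u hu => ?_
  simpa using hu

theorem CoeffNull.exists_bound {R : ℝ} (hR : 0 < R) {ξ : MvPowerSeries (Fin n) F}
    (h : CoeffNull R ξ) : ∃ B, 0 ≤ B ∧ CoeffBound R B ξ := by
  obtain ⟨N, hN⟩ := h 1 one_pos
  obtain ⟨B, hB⟩ := ((finite_degree_lt n N).image fun u => ‖coeff u ξ‖ / R ^ u.degree).bddAbove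
  refine ⟨max 1 B, zero_le_one.trans (le_max_left _ _), fun u => ?_⟩
  rcases lt_or_ge u.degree N with hu | hu
  · rw [← div_le_iff₀ (by positivity)]
    exact (hB ⟨u, hu, rfl⟩).trans (le_max_right _ _)
  · exact (hN u hu).trans (by gcongr; exact le_max_left _ _)

/-- Only finitely many exponents lie below a given degree, so the cofinite filter and growth of the
degree define the same limit. -/
theorem coeffNull_iff_tendsto {R : ℝ} (hR : 0 < R) (ξ : MvPowerSeries (Fin n) F) :
    CoeffNull R ξ ↔ Filter.Tendsto (fun u : Fin n →₀ ℕ => ‖coeff u ξ‖ / R ^ u.degree)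
      Filter.cofinite (nhds 0) := by
  have hnn (u : Fin n →₀ ℕ) : 0 ≤ ‖coeff u ξ‖ / R ^ u.degree := by positivity
  rw [Metric.tendsto_nhds]
  simp only [Real.dist_eq, sub_zero, abs_of_nonneg (hnn _), Filter.eventually_cofinite, not_lt]
  constructor
  · intro h ε hε
    obtain ⟨N, hN⟩ := h (ε / 2) (by positivity)
    refine (finite_degree_lt n N).subset fun u (hu : ε ≤ _) => ?_
    by_contra hlt
    have := hN u (not_lt.mp hlt)
    rw [← div_le_iff₀ (by positivity)] at this
    linarith
  · intro h ε hε
    obtain ⟨N, hN⟩ := ((h ε hε).image Finsupp.degree).bddAbove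
    refine ⟨N + 1, fun u hu => ?_⟩
    rw [← div_le_iff₀ (by positivity)]
    by_contra hlt
    have := hN ⟨u, (not_le.mp hlt).le, rfl⟩
    omega

theorem CoeffNull.of_tail {R : ℝ} (hR : 0 ≤ R) {ξ : MvPowerSeries (Fin n) F} {τ : ℕ → ℝ}
    (hτ : Filter.Tendsto τ Filter.atTop (nhds 0))
    (h : ∀ u, ‖coeff u ξ‖ ≤ τ u.degree * R ^ u.degree) : CoeffNull R ξ := by
  intro ε hε
  obtain ⟨N, hN⟩ := Filter.eventually_atTop.mp (hτ.eventually_le_const hε)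
  exact ⟨N, fun u hu => (h u).trans (by gcongr; exact hN _ hu)⟩

/-- The operator `ξ ↦ ∑_v (∑_{|u| = |v| + s} κ(u, v) ξ_u) x^v`. -/
def kernelOp (s : ℕ) (κ : (Fin n →₀ ℕ) → (Fin n →₀ ℕ) → F) :
    MvPowerSeries (Fin n) F →ₗ[F] MvPowerSeries (Fin n) F :=
  LinearMap.pi fun v => ∑ u ∈ degreeFinset n (v.degree + s), κ u v • coeff u

theorem coeff_kernelOp (s : ℕ) (κ : (Fin n →₀ ℕ) → (Fin n →₀ ℕ) → F)
    (ξ : MvPowerSeries (Fin n) F) (v : Fin n →₀ ℕ) :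
    coeff v (kernelOp s κ ξ) =
      ∑ u ∈ degreeFinset n (v.degree + s), κ u v * coeff u ξ := by
  change (∑ u ∈ degreeFinset n (v.degree + s), κ u v • coeff u) ξ = _
  rw [LinearMap.sum_apply]
  rfl

variable [IsUltrametricDist F]

theorem CoeffBound.add {R B : ℝ} {ξ ξ' : MvPowerSeries (Fin n) F} (h : CoeffBound R B ξ)
    (h' : CoeffBound R B ξ') : CoeffBound R B (ξ + ξ') := fun u => by
  rw [map_add]
  exact (IsUltrametricDist.norm_add_le_max _ _).trans (max_le (h u) (h' u))

theorem CoeffBound.sub {R B : ℝ} {ξ ξ' : MvPowerSeries (Fin n) F} (h : CoeffBound R B ξ)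
    (h' : CoeffBound R B ξ') : CoeffBound R B (ξ - ξ') := fun u => by
  rw [map_sub, sub_eq_add_neg]
  refine (IsUltrametricDist.norm_add_le_max _ _).trans (max_le (h u) ?_)
  rw [norm_neg]
  exact h' u

theorem CoeffBound.sum {R B : ℝ} (hR : 0 ≤ R) (hB : 0 ≤ B) {ι : Type*} (s : Finset ι)
    {ξ : ι → MvPowerSeries (Fin n) F} (h : ∀ i ∈ s, CoeffBound R B (ξ i)) :
    CoeffBound R B (∑ i ∈ s, ξ i) := fun u => by
  rw [map_sum]
  exact IsUltrametricDist.norm_sum_le_of_forall_le_of_nonneg (by positivity) fun i hi => h i hi u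

theorem CoeffBound.mul {R C B : ℝ} (hR : 0 ≤ R) (hC : 0 ≤ C) (hB : 0 ≤ B)
    {G ξ : MvPowerSeries (Fin n) F} (hG : CoeffBound R C G) (hξ : CoeffBound R B ξ) :
    CoeffBound R (C * B) (G * ξ) := fun w => by
  rw [coeff_mul]
  refine IsUltrametricDist.norm_sum_le_of_forall_le_of_nonneg (by positivity) fun x hx => ?_
  rw [Finset.HasAntidiagonal.mem_antidiagonal] at hx
  rw [norm_mul, ← hx, map_add, pow_add]
  calc _ ≤ (C * R ^ x.1.degree) * (B * R ^ x.2.degree) := by gcongr; exacts [hG _, hξ _]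
    _ = _ := by ring

/-- Integers have norm at most one, so differentiation costs only the factor `R` coming from the
degree shift. -/
theorem CoeffBound.pderiv {R B : ℝ} {ξ : MvPowerSeries (Fin n) F}
    (h : CoeffBound R B ξ) (i : Fin n) :
    CoeffBound R (B * R) (MvPowerSeries.pderiv F i ξ) := fun u => by
  rw [coeff_pderiv, norm_mul]
  have h1 : ‖((u i : F) + 1)‖ ≤ 1 := by
    exact_mod_cast IsUltrametricDist.norm_natCast_le_one F (u i + 1)
  have h2 := h (u + Finsupp.single i 1)
  rw [map_add, Finsupp.degree_single, pow_succ] at h2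
  calc _ ≤ ‖coeff (u + Finsupp.single i 1) ξ‖ * 1 := by gcongr
    _ ≤ _ := by linarith

theorem CoeffBound.kernelOp {R B C : ℝ} (hR : 0 ≤ R) (hC : 0 ≤ C) (hB : 0 ≤ B)
    {ξ : MvPowerSeries (Fin n) F} (h : CoeffBound R B ξ) {s : ℕ}
    {κ : (Fin n →₀ ℕ) → (Fin n →₀ ℕ) → F}
    (hκ : ∀ u v, u.degree = v.degree + s → ‖κ u v‖ ≤ C) :
    CoeffBound R (C * R ^ s * B) (kernelOp s κ ξ) := fun v => by
  rw [coeff_kernelOp]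
  refine IsUltrametricDist.norm_sum_le_of_forall_le_of_nonneg (by positivity) fun u hu => ?_
  rw [mem_degreeFinset] at hu
  have := h u
  rw [norm_mul]
  calc _ ≤ C * (B * R ^ u.degree) := by gcongr; exact hκ u v hu
    _ = _ := by rw [hu, pow_add]; ring

/-- The series with coefficients in `Λ` that satisfy `CoeffNull R`. -/
def nullSeries (n : ℕ) (Λ : Subfield F) {R : ℝ} (hR : 0 < R) :
    AddSubgroup (MvPowerSeries (Fin n) F) where
  carrier := {ξ | (∀ u, coeff u ξ ∈ Λ) ∧ CoeffNull R ξ}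
  zero_mem' := ⟨fun u => by simp, fun ε hε => ⟨0, fun u _ => by simp; positivity⟩⟩
  add_mem' {ξ ξ'} h h' := by
    refine ⟨fun u => by rw [map_add]; exact Λ.add_mem (h.1 u) (h'.1 u), fun ε hε => ?_⟩
    obtain ⟨N, hN⟩ := h.2 ε hε
    obtain ⟨N', hN'⟩ := h'.2 ε hε
    refine ⟨max N N', fun u hu => ?_⟩
    rw [map_add]
    exact (IsUltrametricDist.norm_add_le_max _ _).trans
      (max_le (hN u ((le_max_left _ _).trans hu)) (hN' u ((le_max_right _ _).trans hu)))
  neg_mem' {ξ} h := by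
    refine ⟨fun u => by rw [map_neg]; exact Λ.neg_mem (h.1 u), fun ε hε => ?_⟩
    obtain ⟨N, hN⟩ := h.2 ε hε
    exact ⟨N, fun u hu => by rw [map_neg, norm_neg]; exact hN u hu⟩

variable {Λ : Subfield F} {R : ℝ} {hR : 0 < R}

theorem mul_mem_nullSeries {G ξ : MvPowerSeries (Fin n) F} (hG : G ∈ nullSeries n Λ hR)
    (hξ : ξ ∈ nullSeries n Λ hR) : G * ξ ∈ nullSeries n Λ hR := by
  refine ⟨fun u => ?_, fun ε hε => ?_⟩
  · rw [coeff_mul]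
    exact Λ.sum_mem fun x _ => Λ.mul_mem (hG.1 _) (hξ.1 _)
  obtain ⟨C, hC, hGC⟩ := hG.2.exists_bound hR
  obtain ⟨B, hB, hξB⟩ := hξ.2.exists_bound hR
  -- Adding one keeps the divisors positive even if a bound is zero. In degree at least `N + N'`,
  -- one factor of each product is in its small range.
  obtain ⟨N, hN⟩ := hG.2 (ε / (B + 1)) (by positivity)
  obtain ⟨N', hN'⟩ := hξ.2 (ε / (C + 1)) (by positivity)
  refine ⟨N + N', fun w hw => ?_⟩
  rw [coeff_mul]
  refine IsUltrametricDist.norm_sum_le_of_forall_le_of_nonneg (by positivity) fun x hx => ?_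
  rw [Finset.HasAntidiagonal.mem_antidiagonal] at hx
  have hdeg : w.degree = x.1.degree + x.2.degree := by rw [← hx, map_add]
  rw [norm_mul, hdeg, pow_add]
  rcases le_or_gt N x.1.degree with h1 | h1
  · calc _ ≤ (ε / (B + 1) * R ^ x.1.degree) * (B * R ^ x.2.degree) := by
          gcongr; exacts [hN _ h1, hξB _]
      _ = (ε * (B / (B + 1))) * (R ^ x.1.degree * R ^ x.2.degree) := by ring
      _ ≤ _ := by
          gcongr
          exact mul_le_of_le_one_right hε.le (by rw [div_le_one (by positivity)]; linarith)
  · calc _ ≤ (C * R ^ x.1.degree) * (ε / (C + 1) * R ^ x.2.degree) := by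
          gcongr; exacts [hGC _, hN' _ (by omega)]
      _ = (ε * (C / (C + 1))) * (R ^ x.1.degree * R ^ x.2.degree) := by ring
      _ ≤ _ := by
          gcongr
          exact mul_le_of_le_one_right hε.le (by rw [div_le_one (by positivity)]; linarith)

theorem monomial_mem_nullSeries {c : F} (hc : c ∈ Λ) (μ : Fin n →₀ ℕ) :
    monomial μ c ∈ nullSeries n Λ hR := by
  classical
  refine ⟨fun u => ?_, fun ε hε => ⟨μ.degree + 1, fun u hu => ?_⟩⟩
  · rw [coeff_monomial]
    split_ifs
    exacts [hc, Λ.zero_mem]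
  · rw [coeff_monomial, if_neg (by rintro rfl; omega), norm_zero]
    positivity

theorem smul_mem_nullSeries {c : F} (hc : c ∈ Λ) {ξ : MvPowerSeries (Fin n) F}
    (hξ : ξ ∈ nullSeries n Λ hR) : c • ξ ∈ nullSeries n Λ hR := by
  rw [smul_eq_C_mul]
  exact mul_mem_nullSeries (monomial_mem_nullSeries hc 0) hξ

theorem pderiv_mem_nullSeries {ξ : MvPowerSeries (Fin n) F} (hξ : ξ ∈ nullSeries n Λ hR)
    (i : Fin n) : pderiv F i ξ ∈ nullSeries n Λ hR := by
  refine ⟨fun u => ?_, fun ε hε => ?_⟩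
  · rw [coeff_pderiv]
    exact Λ.mul_mem (hξ.1 _) (Λ.add_mem (natCast_mem Λ _) Λ.one_mem)
  obtain ⟨N, hN⟩ := hξ.2 (ε / R) (by positivity)
  refine ⟨N, fun u hu => ?_⟩
  have h1 : ‖((u i : F) + 1)‖ ≤ 1 := by
    exact_mod_cast IsUltrametricDist.norm_natCast_le_one F (u i + 1)
  have h2 := hN (u + Finsupp.single i 1) (by rw [map_add]; omega)
  rw [map_add, Finsupp.degree_single, pow_succ] at h2
  rw [coeff_pderiv, norm_mul]
  calc _ ≤ ‖coeff (u + Finsupp.single i 1) ξ‖ * 1 := by gcongr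
    _ ≤ ε / R * (R ^ u.degree * R) := by linarith
    _ = _ := by field_simp

theorem kernelOp_mem_nullSeries {ξ : MvPowerSeries (Fin n) F} (hξ : ξ ∈ nullSeries n Λ hR)
    {s : ℕ} {κ : (Fin n →₀ ℕ) → (Fin n →₀ ℕ) → F} (hΛ : ∀ u v, κ u v ∈ Λ)
    (hκ : ∀ u v, ‖κ u v‖ ≤ 1) : kernelOp s κ ξ ∈ nullSeries n Λ hR := by
  refine ⟨fun v => ?_, fun ε hε => ?_⟩
  · rw [coeff_kernelOp]
    exact Λ.sum_mem fun u _ => Λ.mul_mem (hΛ u v) (hξ.1 u)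
  obtain ⟨N, hN⟩ := hξ.2 (ε / R ^ s) (by positivity)
  refine ⟨N, fun v hv => ?_⟩
  rw [coeff_kernelOp]
  refine IsUltrametricDist.norm_sum_le_of_forall_le_of_nonneg (by positivity) fun u hu => ?_
  rw [mem_degreeFinset] at hu
  have := hN u (by omega)
  rw [hu, pow_add] at this
  rw [norm_mul]
  calc _ ≤ 1 * (ε / R ^ s * (R ^ v.degree * R ^ s)) := by gcongr; exact hκ u v
    _ = _ := by field_simp

/-- A contracting linear operator on the Banach space of null series admits, for every `η`, a
solution of `S = η + E S` which is bounded by the same constant as `η`. -/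
theorem exists_eq_add_apply_of_contracting [CompleteSpace Λ] {ϖ : F} (hϖ : ϖ ∈ Λ)
    (hϖR : ‖ϖ‖ = R) (E : MvPowerSeries (Fin n) F →ₗ[F] MvPowerSeries (Fin n) F)
    {θ : ℝ} (hθ0 : 0 ≤ θ) (hθ1 : θ < 1)
    (hE : ∀ ξ ∈ nullSeries n Λ hR, E ξ ∈ nullSeries n Λ hR)
    (hEB : ∀ ξ ∈ nullSeries n Λ hR, ∀ B, 0 ≤ B → CoeffBound R B ξ → CoeffBound R (θ * B) (E ξ))
    {η : MvPowerSeries (Fin n) F} (hη : η ∈ nullSeries n Λ hR) {B : ℝ} (hB : 0 ≤ B)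
    (hηB : CoeffBound R B η) :
    ∃ S ∈ nullSeries n Λ hR, CoeffBound R B S ∧ S = η + E S := by
  -- With discrete exponents, the functions vanishing at infinity form a complete space; dividing
  -- the coefficient at `u` by `ϖ ^ |u|` identifies null series with it.
  let _ : TopologicalSpace (Fin n →₀ ℕ) := ⊥
  have : DiscreteTopology (Fin n →₀ ℕ) := ⟨rfl⟩
  have hϖ0 : ϖ ≠ 0 := by rw [← norm_pos_iff, hϖR]; exact hR
  let X := ZeroAtInftyContinuousMap (Fin n →₀ ℕ) Λ
  have hdist (A A' : X) {C : ℝ} (hC : 0 ≤ C) (h : ∀ u, dist (A u) (A' u) ≤ C) :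
      dist A A' ≤ C := by
    rw [← ZeroAtInftyContinuousMap.dist_toBCF_eq_dist]
    exact (BoundedContinuousFunction.dist_le hC).mpr h
  have hcoe (A A' : X) (u : Fin n →₀ ℕ) : dist (A u) (A' u) ≤ dist A A' := by
    rw [← ZeroAtInftyContinuousMap.dist_toBCF_eq_dist]
    exact BoundedContinuousFunction.dist_coe_le_dist (f := A.toBCF) (g := A'.toBCF) u
  let toX (ξ : MvPowerSeries (Fin n) F) (h : ξ ∈ nullSeries n Λ hR) : X :=
    ⟨⟨fun u => ⟨coeff u ξ / ϖ ^ u.degree, Λ.div_mem (h.1 u) (Λ.pow_mem hϖ _)⟩,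
      continuous_of_discreteTopology⟩, by
      rw [Filter.cocompact_eq_cofinite, tendsto_zero_iff_norm_tendsto_zero]
      have := (coeffNull_iff_tendsto hR ξ).mp h.2
      refine this.congr fun u => ?_
      change _ = ‖coeff u ξ / ϖ ^ u.degree‖
      rw [norm_div, norm_pow, hϖR]⟩
  let ofX (A : X) : MvPowerSeries (Fin n) F := fun u => (A u : F) * ϖ ^ u.degree
  have coeff_ofX (A : X) (u) : coeff u (ofX A) = (A u : F) * ϖ ^ u.degree := rfl
  have coe_zero (u) : (((0 : X) u : Λ) : F) = 0 := rfl
  have ofX_mem (A : X) : ofX A ∈ nullSeries n Λ hR := by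
    refine ⟨fun u => Λ.mul_mem (A u).2 (Λ.pow_mem hϖ _), ?_⟩
    rw [coeffNull_iff_tendsto hR]
    have := A.zero_at_infty'
    rw [Filter.cocompact_eq_cofinite, tendsto_zero_iff_norm_tendsto_zero] at this
    refine this.congr fun u => ?_
    rw [coeff_ofX, norm_mul, norm_pow, hϖR, mul_div_cancel_right₀ _ (by positivity)]
    rfl
  have hmem (A : X) : η + E (ofX A) ∈ nullSeries n Λ hR := add_mem hη (hE _ (ofX_mem A))
  let f (A : X) : X := toX (η + E (ofX A)) (hmem A)
  have hf : ContractingWith ⟨θ, hθ0⟩ f := by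
    refine ⟨by exact_mod_cast hθ1, LipschitzWith.of_dist_le_mul fun A A' => ?_⟩
    refine hdist _ _ (mul_nonneg hθ0 dist_nonneg) fun u => ?_
    have hb : CoeffBound R (dist A A') (ofX A - ofX A') := fun v => by
      rw [map_sub, coeff_ofX, coeff_ofX, ← sub_mul, norm_mul, norm_pow, hϖR]
      gcongr
      have := hcoe A A' v
      rw [dist_eq_norm] at this
      exact this
    have h1 := hEB _ (sub_mem (ofX_mem A) (ofX_mem A')) _ dist_nonneg hb u
    rw [dist_eq_norm]
    change ‖coeff u (η + E (ofX A)) / ϖ ^ u.degree - coeff u (η + E (ofX A')) / ϖ ^ u.degree‖ ≤ _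
    rw [← sub_div, ← map_sub, add_sub_add_left_eq_sub, ← map_sub, norm_div, norm_pow, hϖR,
      div_le_iff₀ (by positivity)]
    exact h1
  let A := hf.fixedPoint f
  have hA : f A = A := hf.fixedPoint_isFixedPt
  have hS : ofX A = η + E (ofX A) := by
    ext u
    have : ((f A) u : F) = A u := by rw [hA]
    rw [coeff_ofX, ← this]
    change coeff u (η + E (ofX A)) / ϖ ^ u.degree * ϖ ^ u.degree = _
    rw [div_mul_cancel₀ _ (pow_ne_zero _ hϖ0)]
  have hSB : CoeffBound R (dist A 0) (ofX A) := fun u => by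
    rw [coeff_ofX, norm_mul, norm_pow, hϖR]
    gcongr
    have h : ‖(A u : F) - ((0 : X) u : Λ)‖ ≤ dist A 0 := (dist_eq_norm (A u) _).symm.trans_le (hcoe A 0 u)
    rwa [coe_zero, sub_zero] at h
  -- Ultrametric bound on `S = η + E S`. As `θ < 1`, the second alternative forces the norm to
  -- vanish, so no constant is lost.
  have hle : dist A 0 ≤ max B (θ * dist A 0) := by
    refine hdist _ _ (hB.trans (le_max_left _ _)) fun u => ?_
    have h1 := hEB _ (ofX_mem A) _ dist_nonneg hSB u
    have h2 : ‖coeff u (ofX A)‖ ≤ max B (θ * dist A 0) * R ^ u.degree := by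
      rw [hS, map_add, max_mul_of_nonneg _ _ (by positivity)]
      exact (IsUltrametricDist.norm_add_le_max _ _).trans (max_le_max (hηB u) h1)
    rw [coeff_ofX, norm_mul, norm_pow, hϖR] at h2
    rw [dist_eq_norm]
    change ‖(A u : F) - ((0 : X) u : Λ)‖ ≤ _
    rw [coe_zero, sub_zero]
    exact le_of_mul_le_mul_right h2 (by positivity)
  have hle' : dist A 0 ≤ B := by
    rcases le_max_iff.mp hle with h | h
    · exact h
    · nlinarith [dist_nonneg (x := A) (y := 0)]
  refine ⟨ofX A, ofX_mem A, fun u => (hSB u).trans (by gcongr), hS⟩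

end WeightedSeries

/-! ### Reduction to the chosen monomials by successive approximation -/

section Reduction

open MvPowerSeries

variable {F : Type*} [NormedField F] [IsUltrametricDist F] {n : ℕ} {Λ : Subfield F}

/-- Let `G_i` be homogeneous of degree `s` such that modulo elements of norm `≤ θ` every monomial
`x^u` is a combination of the `x^{μ_j}` of the same degree and of multiples of the `G_i`, and let
`Q_i` be a small deformation of `G_i`.  Then every null series is a combination of the `x^{μ_j}`
modulo the images of the operators `c₀ ∂_i + Q_i`. -/
theorem exists_reduction [CompleteSpace Λ] {ϖ : F} (hϖ : ϖ ∈ Λ) (hR : 0 < ‖ϖ‖)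
    {θ : ℝ} (hθ0 : 0 ≤ θ) (hθ1 : θ < 1) {s : ℕ} {c₀ : F} (hc₀ : c₀ ∈ Λ)
    (hc₀θ : ‖c₀‖ * ‖ϖ‖ ^ (s + 1) ≤ θ)
    {Q G : Fin n → MvPowerSeries (Fin n) F}
    (hG : ∀ i v, coeff v (G i) ≠ 0 → v.degree = s)
    (hQ : ∀ i, Q i ∈ nullSeries n Λ hR)
    (hQG : ∀ i v, ‖coeff v (Q i - G i)‖ * ‖ϖ‖ ^ s ≤ θ * ‖ϖ‖ ^ v.degree)
    {ι : Type*} [Fintype ι] (μ : ι → (Fin n →₀ ℕ))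
    (a : (Fin n →₀ ℕ) → ι → F) (ha : ∀ u j, a u j ∈ Λ) (ha1 : ∀ u j, ‖a u j‖ ≤ 1)
    (h : Fin n → (Fin n →₀ ℕ) → (Fin n →₀ ℕ) → F) (hh : ∀ i u v, h i u v ∈ Λ)
    (hh1 : ∀ i u v, ‖h i u v‖ ≤ 1)
    (hκ : ∀ u v : Fin n →₀ ℕ, u.degree = v.degree →
      ‖coeff v (monomial u (1 : F) - ∑ j, monomial (μ j) (a u j)) -
        ∑ i, ∑ x ∈ Finset.HasAntidiagonal.antidiagonal v, coeff x.1 (G i) * h i u x.2‖ ≤ θ)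
    {η : MvPowerSeries (Fin n) F} (hη : η ∈ nullSeries n Λ hR) {B : ℝ} (hB : 0 ≤ B)
    (hηB : CoeffBound ‖ϖ‖ B η) :
    ∃ (c : ι → F) (ω : Fin n → MvPowerSeries (Fin n) F),
      (∀ j, c j ∈ Λ ∧ ‖c j‖ ≤ B * ‖ϖ‖ ^ (μ j).degree) ∧ (∀ i, ω i ∈ nullSeries n Λ hR) ∧
      η = ∑ j, monomial (μ j) (c j) + ∑ i, (c₀ • pderiv F i (ω i) + Q i * ω i) := by
  classical
  -- Restricting to `|u| = |μ_j|` makes the sum finite and lets the weight `R ^ |u|` pass unchanged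
  -- to the coefficient of `x^{μ_j}`.
  let cf (j : ι) : MvPowerSeries (Fin n) F →ₗ[F] F :=
    ∑ u ∈ degreeFinset n (μ j).degree, a u j • coeff u
  have cf_apply (j : ι) (ξ : MvPowerSeries (Fin n) F) :
      cf j ξ = ∑ u ∈ degreeFinset n (μ j).degree, a u j * coeff u ξ := by
    simp only [cf, LinearMap.sum_apply]
    rfl
  let H (i : Fin n) := kernelOp s (h i)
  -- The approximate reduction: every value has the desired shape, with `G_i` already replaced by
  -- the true operator `c₀ ∂_i + Q_i`.
  let N (ξ : MvPowerSeries (Fin n) F) : MvPowerSeries (Fin n) F :=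
    ∑ j, monomial (μ j) (cf j ξ) + ∑ i, (c₀ • pderiv F i (H i ξ) + Q i * H i ξ)
  let E : MvPowerSeries (Fin n) F →ₗ[F] MvPowerSeries (Fin n) F :=
    LinearMap.id - (∑ j, (monomial (μ j)).comp (cf j) + ∑ i, (c₀ • (pderiv F i).toLinearMap.comp (H i)
      + (LinearMap.mulLeft F (Q i)).comp (H i)))
  have E_apply (ξ) : E ξ = ξ - N ξ := by
    simp only [E, N, LinearMap.sub_apply, LinearMap.add_apply, LinearMap.sum_apply]
    rfl
  let κ (u v : Fin n →₀ ℕ) : F :=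
    coeff v (monomial u (1 : F) - ∑ j, monomial (μ j) (a u j)) -
        ∑ i, ∑ x ∈ Finset.HasAntidiagonal.antidiagonal v, coeff x.1 (G i) * h i u x.2
  have H_mem {ξ} (hξ : ξ ∈ nullSeries n Λ hR) (i) : H i ξ ∈ nullSeries n Λ hR :=
    kernelOp_mem_nullSeries hξ (hh i) (hh1 i)
  have cf_mem {ξ} (hξ : ξ ∈ nullSeries n Λ hR) (j) : cf j ξ ∈ Λ := by
    rw [cf_apply]
    exact Λ.sum_mem fun u _ => Λ.mul_mem (ha u j) (hξ.1 u)
  have N_mem {ξ} (hξ : ξ ∈ nullSeries n Λ hR) : N ξ ∈ nullSeries n Λ hR :=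
    add_mem (sum_mem fun j _ => monomial_mem_nullSeries (cf_mem hξ j) _)
      (sum_mem fun i _ => add_mem (smul_mem_nullSeries hc₀ (pderiv_mem_nullSeries (H_mem hξ i) i))
        (mul_mem_nullSeries (hQ i) (H_mem hξ i)))
  -- The error splits into the degree-preserving congruence error `κ`, the derivative term and the
  -- deformation `Q_i - G_i`; each is bounded by `θ`.
  have E_decomp (ξ) : E ξ = kernelOp 0 κ ξ -
      ∑ i, (c₀ • pderiv F i (H i ξ) + (Q i - G i) * H i ξ) := by
    have hker : kernelOp 0 κ ξ = ξ - ∑ j, monomial (μ j) (cf j ξ) - ∑ i, G i * H i ξ := by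
      ext v
      rw [coeff_kernelOp, add_zero]
      simp only [κ, sub_mul, Finset.sum_sub_distrib, map_sub, map_sum]
      congr 1
      · congr 1
        · rw [Finset.sum_eq_single v]
          · simp
          · intro u _ hu
            rw [coeff_monomial, if_neg hu.symm, zero_mul]
          · simp
        · simp_rw [Finset.sum_mul]
          rw [Finset.sum_comm]
          refine Finset.sum_congr rfl fun j _ => ?_
          simp only [coeff_monomial]
          split_ifs with hv
          · rw [cf_apply, hv]
          · simp
      · simp_rw [Finset.sum_mul]
        rw [Finset.sum_comm]
        refine Finset.sum_congr rfl fun i _ => ?_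
        rw [coeff_mul, Finset.sum_comm]
        refine Finset.sum_congr rfl fun x hx => ?_
        -- Homogeneity of `G i` matches the shift by `s` in `H i` with equality of the degrees of
        -- `u` and `v`.
        by_cases hx0 : coeff x.1 (G i) = 0
        · simp [hx0]
        · rw [coeff_kernelOp, Finset.mul_sum]
          have hd : v.degree = x.2.degree + s := by
            rw [← Finset.HasAntidiagonal.mem_antidiagonal.mp hx, map_add, hG i _ hx0, add_comm]
          rw [hd]
          exact Finset.sum_congr rfl fun u _ => by ring
    rw [E_apply, hker]
    simp only [N, sub_mul, Finset.sum_add_distrib, Finset.sum_sub_distrib]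
    abel
  obtain ⟨S, hS, hSB, hSE⟩ := exists_eq_add_apply_of_contracting (hR := hR) hϖ rfl E hθ0 hθ1
    (fun ξ hξ => by rw [E_apply]; exact sub_mem hξ (N_mem hξ))
    (fun ξ hξ C hC hξC => by
      have hHb (i) : CoeffBound ‖ϖ‖ (1 * ‖ϖ‖ ^ s * C) (H i ξ) :=
        hξC.kernelOp hR.le zero_le_one hC fun u v _ => hh1 i u v
      rw [E_decomp]
      refine CoeffBound.sub ?_ (CoeffBound.sum hR.le (by positivity) _ fun i _ => CoeffBound.add ?_ ?_)
      · have := hξC.kernelOp (s := 0) (κ := κ) hR.le hθ0 hC fun u v huv => hκ u v huv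
        simpa using this
      · intro u
        have := (hHb i).pderiv i u
        rw [map_smul, norm_smul]
        calc _ ≤ ‖c₀‖ * (1 * ‖ϖ‖ ^ s * C * ‖ϖ‖ * ‖ϖ‖ ^ u.degree) := by gcongr
          _ = (‖c₀‖ * ‖ϖ‖ ^ (s + 1)) * C * ‖ϖ‖ ^ u.degree := by ring
          _ ≤ _ := by gcongr
      · have hb : CoeffBound ‖ϖ‖ (θ / ‖ϖ‖ ^ s) (Q i - G i) := fun v => by
          rw [div_mul_eq_mul_div, le_div_iff₀ (by positivity)]
          exact hQG i v
        have := hb.mul hR.le (by positivity) (by positivity) (hHb i)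
        convert this using 1
        field_simp)
    hη hB hηB
  refine ⟨fun j => cf j S, fun i => H i S, fun j => ⟨cf_mem hS j, ?_⟩, H_mem hS, ?_⟩
  · change ‖cf j S‖ ≤ _
    rw [cf_apply]
    refine IsUltrametricDist.norm_sum_le_of_forall_le_of_nonneg (by positivity) fun u hu => ?_
    rw [mem_degreeFinset] at hu
    rw [norm_mul, ← hu, ← one_mul (B * _)]
    gcongr
    exacts [ha1 u j, hSB u]
  · rw [E_apply] at hSE
    -- The fixed-point equation says `N S = η`.
    have : η = S - (S - N S) := by rw [eq_sub_iff_add_eq]; exact hSE.symm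
    rw [this, sub_sub_cancel]

end Reduction

/-! ### Teichmüller representatives and reduction modulo `p` -/

section Teichmuller

variable {p : ℕ} [Fact p.Prime] {a : ℕ} {Fq : Type*} [Field Fq] [Fintype Fq]

theorem norm_prime_lt_one (p : ℕ) [Fact p.Prime] : ‖(p : ℂ_[p])‖ < 1 := by
  rw [← map_natCast (algebraMap ℚ_[p] ℂ_[p]), norm_algebraMap']
  exact Padic.norm_p_lt_one

theorem norm_prime (p : ℕ) [Fact p.Prime] : ‖(p : ℂ_[p])‖ = (p : ℝ)⁻¹ := by
  rw [← map_natCast (algebraMap ℚ_[p] ℂ_[p]), norm_algebraMap']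
  exact Padic.norm_p

/-- If `‖z‖ < 1`, then `1 - z ^ (q - 1)`, with `q` the cardinality of `Fq`, has norm one and is a
unit of the integers; but `ρ` kills it when `ρ z ≠ 0`. -/
theorem norm_eq_one_of_map_ne_zero {L : IntermediateField ℚ_[p] ℂ_[p]} (ρ : integers L →+* Fq)
    {z : integers L} (hz : ρ z ≠ 0) : ‖((z : L) : ℂ_[p])‖ = 1 := by
  refine le_antisymm z.2 (not_lt.mp fun hlt => ?_)
  set N := Fintype.card Fq - 1
  have hN : N ≠ 0 := by have := Fintype.one_lt_card (α := Fq); omega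
  have h1 : ‖(((z ^ N : integers L) : L) : ℂ_[p])‖ < 1 := by
    push_cast
    rw [norm_pow]
    exact pow_lt_one₀ (norm_nonneg _) hlt hN
  set w : integers L := 1 - z ^ N
  have hw : ‖((w : L) : ℂ_[p])‖ = 1 := by
    have := IsUltrametricDist.norm_add_eq_max_of_norm_ne_norm
      (x := (1 : ℂ_[p])) (y := -(((z ^ N : integers L) : L) : ℂ_[p]))
      (by rw [norm_neg, norm_one]; exact h1.ne')
    rw [norm_neg, norm_one, max_eq_left h1.le] at this
    rw [← this]
    congr 1
    simp [w, sub_eq_add_neg]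
  have hw0 : (w : L) ≠ 0 := fun h => by rw [h] at hw; simp at hw
  let w' : integers L := ⟨(w : L)⁻¹, by
    change ‖(((w : L)⁻¹ : L) : ℂ_[p])‖ ≤ 1
    push_cast
    rw [norm_inv, hw, inv_one]⟩
  have hww : w * w' = 1 := Subtype.ext (mul_inv_cancel₀ hw0)
  have h2 : ρ w = 0 := by
    simp only [w, map_sub, map_one, map_pow]
    rw [FiniteField.pow_card_sub_one_eq_one _ hz, sub_self]
  have := congrArg ρ hww
  rw [map_mul, h2, zero_mul, map_one] at this
  exact zero_ne_one this

/-- The subring generated by the Teichmüller representatives. -/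
def teichmullerRing (p : ℕ) [Fact p.Prime] (a : ℕ) : Subring (integers (unramified p a)) :=
  Subring.closure {x | x ^ p ^ a = x}

/-- The congruence `x ^ q ≡ x` modulo `p` is an equality on generators and survives ring operations,
since `q`-th powers are additive modulo `p`. -/
theorem dvd_pow_sub_of_mem_teichmullerRing {x : integers (unramified p a)}
    (hx : x ∈ teichmullerRing p a) : (p : integers (unramified p a)) ∣ x ^ p ^ a - x := by
  have hp : p.Prime := Fact.out
  have hq : p ^ a ≠ 0 := pow_ne_zero _ hp.ne_zero
  induction hx using Subring.closure_induction with
  | mem x hx => rw [show x ^ p ^ a = x from hx, sub_self]; exact dvd_zero _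
  | zero => rw [zero_pow hq, sub_self]; exact dvd_zero _
  | one => simp
  | add x y _ _ hx hy =>
    obtain ⟨r, hr⟩ := exists_add_pow_prime_pow_eq hp x y a
    obtain ⟨s, hs⟩ := hx
    obtain ⟨t, ht⟩ := hy
    exact ⟨s + t + x * y * r, by rw [hr]; linear_combination hs + ht⟩
  | neg x _ hx =>
    obtain ⟨r, hr⟩ := exists_add_pow_prime_pow_eq hp x (-x) a
    obtain ⟨s, hs⟩ := hx
    rw [add_neg_cancel, zero_pow hq] at hr
    exact ⟨-s + x * x * r, by linear_combination -hs - hr⟩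
  | mul x y _ _ hx hy =>
    obtain ⟨s, hs⟩ := hx
    obtain ⟨t, ht⟩ := hy
    exact ⟨s * y ^ p ^ a + x * t, by rw [mul_pow]; linear_combination y ^ p ^ a * hs + x * ht⟩

/-- Here `x (1 - x ^ (q - 1))` is divisible by `p`, and the second factor has norm one because it
reduces to `1`. This serves in place of the fact that `p` generates the maximal ideal of the
integers of `K`. -/
theorem norm_le_of_mem_teichmullerRing (hFq : Fintype.card Fq = p ^ a)
    (ρ : integers (unramified p a) →+* Fq) {x : integers (unramified p a)}
    (hx : x ∈ teichmullerRing p a) (h0 : ρ x = 0) :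
    ‖((x : unramified p a) : ℂ_[p])‖ ≤ ‖(p : ℂ_[p])‖ := by
  obtain ⟨y, hy⟩ := dvd_pow_sub_of_mem_teichmullerRing hx
  have hq : 1 < p ^ a := hFq ▸ Fintype.one_lt_card
  have h1 : ‖(((1 - x ^ (p ^ a - 1) : integers (unramified p a)) : unramified p a) : ℂ_[p])‖ = 1 := by
    refine norm_eq_one_of_map_ne_zero ρ ?_
    rw [map_sub, map_pow, h0, zero_pow (by omega), map_one, sub_zero]
    exact one_ne_zero
  have h2 : x * (1 - x ^ (p ^ a - 1)) = -(p * y) := by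
    rw [← hy, mul_sub, ← pow_succ', Nat.sub_add_cancel hq.le]
    ring
  have h3 := congrArg (fun z : integers (unramified p a) => ‖((z : unramified p a) : ℂ_[p])‖) h2
  simp only [Subring.coe_mul, IntermediateField.coe_mul, norm_mul, h1, mul_one, Subring.coe_neg,
    IntermediateField.coe_neg, norm_neg] at h3
  rw [h3]
  exact mul_le_of_le_one_right (norm_nonneg _) y.2

/-- A primitive `(q - 1)`-th root of unity of `ℂ_p` lies in `K`, and its reduction stays primitive,
so the powers of the reduction exhaust the nonzero elements of `Fq`. -/
theorem exists_teichmuller (hFq : Fintype.card Fq = p ^ a)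
    (ρ : integers (unramified p a) →+* Fq) (c : Fq) :
    ∃ x : integers (unramified p a), x ^ p ^ a = x ∧ ρ x = c := by
  have hq : 1 < p ^ a := hFq ▸ Fintype.one_lt_card
  by_cases hc : c = 0
  · exact ⟨0, zero_pow (by omega), by rw [map_zero, hc]⟩
  set N := p ^ a - 1
  have hN : N ≠ 0 := by omega
  have hNq : p ^ a = N + 1 := by omega
  have : NeZero N := ⟨hN⟩
  have : NeZero (N : ℂ_[p]) := ⟨Nat.cast_ne_zero.mpr hN⟩
  obtain ⟨θ, hθ⟩ := HasEnoughRootsOfUnity.exists_primitiveRoot ℂ_[p] N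
  have hθK : θ ∈ unramified p a := IntermediateField.subset_adjoin _ _ (by
    change θ ^ p ^ a = θ
    rw [hNq, pow_succ, hθ.pow_eq_one, one_mul])
  have hθ1 : ‖θ‖ = 1 := by
    have := congrArg norm hθ.pow_eq_one
    rw [norm_pow, norm_one] at this
    exact (pow_eq_one_iff_of_nonneg (norm_nonneg _) hN).mp this
  let θ' : integers (unramified p a) := ⟨⟨θ, hθK⟩, hθ1.le⟩
  have hθ'inj (z : integers (unramified p a)) : z = 1 ↔ ((z : unramified p a) : ℂ_[p]) = 1 := by
    constructor
    · rintro rfl; rfl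
    · intro h; exact Subtype.ext (Subtype.ext h)
  have hθ' : IsPrimitiveRoot θ' N := by
    refine ⟨(hθ'inj _).mpr hθ.pow_eq_one, fun l hl => hθ.dvd_of_pow_eq_one l ?_⟩
    exact (hθ'inj _).mp hl
  have hρN : ρ θ' ^ N = 1 := by rw [← map_pow, hθ'.pow_eq_one, map_one]
  have hcard0 : (N : Fq) + 1 = 0 := by
    have := FiniteField.cast_card_eq_zero Fq
    rw [hFq, hNq] at this
    exact_mod_cast this
  have hρ : IsPrimitiveRoot (ρ θ') N := by
    refine ⟨hρN, fun l hl => hθ'.dvd_of_pow_eq_one l ?_⟩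
    by_contra hne
    -- If `θ' ^ l ≠ 1` reduced to `1`, its vanishing geometric sum would reduce to `N = q - 1 = -1`
    -- in `Fq`.
    have hgeom := mul_geom_sum (θ' ^ l) N
    rw [← pow_mul, mul_comm l, pow_mul, hθ'.pow_eq_one, one_pow, sub_self] at hgeom
    have h0 := (mul_eq_zero.mp hgeom).resolve_left (sub_ne_zero.mpr hne)
    have := congrArg ρ h0
    rw [map_sum, map_zero] at this
    simp only [map_pow, hl, one_pow, Finset.sum_const, Finset.card_range, nsmul_eq_mul,
      mul_one] at this
    rw [this, zero_add] at hcard0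
    exact one_ne_zero hcard0
  obtain ⟨i, -, hi⟩ := hρ.eq_pow_of_pow_eq_one (ξ := c)
    (by have := FiniteField.pow_card_sub_one_eq_one c hc; rwa [hFq] at this)
  refine ⟨θ' ^ i, ?_, by rw [map_pow, hi]⟩
  rw [← pow_mul, mul_comm, pow_mul, hNq, pow_succ, hθ'.pow_eq_one, one_mul]

variable {n : ℕ} {ρ : integers (unramified p a) →+* Fq} {f : MvPolynomial (Fin n) Fq}
  {fhat : MvPolynomial (Fin n) (unramified p a)}

/-- A nonzero coefficient of the lift is a `(q - 1)`-th root of unity and cannot reduce to zero.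
Hence lifting does not raise the degree. -/
theorem IsTeichmullerLift.coeff_eq_zero (hFq : Fintype.card Fq = p ^ a)
    (h : IsTeichmullerLift ρ f fhat) {u : Fin n →₀ ℕ} (hu : f.coeff u = 0) :
    fhat.coeff u = 0 := by
  have hq : 1 < p ^ a := hFq ▸ Fintype.one_lt_card
  obtain ⟨x, hx, hxρ⟩ := h.reduces u
  by_contra h0
  have h1 : fhat.coeff u ^ (p ^ a - 1) = 1 := by
    have := h.pow_eq u
    rw [← Nat.sub_add_cancel hq.le, pow_succ] at this
    exact mul_right_cancel₀ h0 (this.trans (one_mul _).symm)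
  have h2 : x ^ (p ^ a - 1) = 1 := Subtype.ext (by rw [← hx] at h1; exact h1)
  have := congrArg ρ h2
  rw [map_pow, hxρ, hu, zero_pow (by omega), map_one] at this
  exact zero_ne_one this

theorem IsTeichmullerLift.coeff_pderiv_eq_zero (hFq : Fintype.card Fq = p ^ a)
    (h : IsTeichmullerLift ρ f fhat) {i : Fin n} {s : Fin n →₀ ℕ}
    (hs : f.totalDegree < s.degree + 1) : (MvPolynomial.pderiv i fhat).coeff s = 0 := by
  rw [MvPolynomial.coeff_pderiv, h.coeff_eq_zero hFq, zero_mul]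
  refine MvPolynomial.coeff_eq_zero_of_totalDegree_lt ?_
  change _ < (s + Finsupp.single i 1).degree
  rwa [map_add, Finsupp.degree_single]

theorem norm_le_one_of_pow_eq (hFq : Fintype.card Fq = p ^ a) {x : ℂ_[p]} (hx : x ^ p ^ a = x) :
    ‖x‖ ≤ 1 := by
  have hq : 1 < p ^ a := hFq ▸ Fintype.one_lt_card
  by_contra! h
  have := congrArg norm hx
  rw [norm_pow] at this
  exact (lt_self_pow₀ h hq).ne' this

theorem IsTeichmullerLift.norm_coeff_pderiv_le (hFq : Fintype.card Fq = p ^ a)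
    (h : IsTeichmullerLift ρ f fhat) (τ : unramified p a ≃ₐ[ℚ_[p]] unramified p a) (i : Fin n)
    (s : Fin n →₀ ℕ) : ‖((τ ((MvPolynomial.pderiv i fhat).coeff s) : unramified p a) : ℂ_[p])‖ ≤ 1 := by
  rw [MvPolynomial.coeff_pderiv, map_mul, map_add, map_natCast, map_one]
  push_cast
  rw [norm_mul]
  refine mul_le_one₀ (norm_le_one_of_pow_eq hFq ?_) (norm_nonneg _) ?_
  · have := h.pow_eq (s + Finsupp.single i 1)
    have := congrArg τ this
    rw [map_pow] at this
    exact_mod_cast congrArg Subtype.val this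
  · exact_mod_cast IsUltrametricDist.norm_natCast_le_one ℂ_[p] (s i + 1)

end Teichmuller

/-- The coefficients of `∂f̂/∂x_i` are integral, lie in the Teichmüller ring, and reduce to those of
`∂f/∂x_i`. -/
theorem IsTeichmullerLift.exists_coeff_pderiv {p : ℕ} [Fact p.Prime] {a n : ℕ} {Fq : Type*} [Field Fq]
    {ρ : integers (unramified p a) →+* Fq} {f : MvPolynomial (Fin n) Fq}
    {fhat : MvPolynomial (Fin n) (unramified p a)} (h : IsTeichmullerLift ρ f fhat) (i : Fin n)
    (s : Fin n →₀ ℕ) : ∃ x ∈ teichmullerRing p a,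
      (x : unramified p a) = (MvPolynomial.pderiv i fhat).coeff s ∧
      ρ x = (MvPolynomial.pderiv i f).coeff s := by
  obtain ⟨x, hx, hxρ⟩ := h.reduces (s + Finsupp.single i 1)
  refine ⟨x * (s i + 1 : ℕ), Subring.mul_mem _ (Subring.subset_closure (Subtype.ext ?_))
    (natCast_mem _ _), ?_, ?_⟩
  · have := h.pow_eq (s + Finsupp.single i 1)
    rw [← hx] at this
    exact this
  · rw [MvPolynomial.coeff_pderiv, ← hx]
    push_cast
    rfl
  · rw [MvPolynomial.coeff_pderiv, map_mul, hxρ, map_natCast]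
    push_cast
    rfl

/-! ### Estimates for the series `H_i` -/

section Coefficients

variable {p : ℕ} [Fact p.Prime] {a n : ℕ}

/-- The full series sums to zero, so `γ_l` is minus its tail, and the tail is bounded by its first
term because the norms of the terms decrease. The factor `‖γ‖ ^ p = ‖p‖ ‖γ‖` clears the denominator
`p ^ (l + 1)`. -/
theorem norm_gammaPartial_mul_le {γ : ℂ_[p]}
    (hsum : HasSum (fun i : ℕ => γ ^ p ^ i / (p : ℂ_[p]) ^ i) 0)
    (hγ1 : ‖γ‖ < 1) (hγp : ‖γ‖ ^ (p - 1) = ‖(p : ℂ_[p])‖) (l : ℕ) :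
    ‖gammaPartial γ l * (p : ℂ_[p]) ^ l‖ * ‖γ‖ ^ p ≤ ‖γ‖ ^ (p ^ (l + 1) + 1) := by
  have hp : p.Prime := Fact.out
  have hp0 : (p : ℂ_[p]) ≠ 0 := Nat.cast_ne_zero.mpr hp.ne_zero
  have hpn : 0 < ‖(p : ℂ_[p])‖ := norm_pos_iff.mpr hp0
  have hγ0 : 0 < ‖γ‖ := by
    refine (norm_nonneg γ).lt_of_ne fun h => ?_
    rw [← h, zero_pow (by have := hp.one_lt; omega)] at hγp
    exact hpn.ne hγp
  set T : ℕ → ℝ := fun i => ‖γ ^ p ^ i / (p : ℂ_[p]) ^ i‖ with hT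
  -- With `‖p‖ = ‖γ‖ ^ (p - 1)`, comparing consecutive terms amounts to `p ^ i + (p - 1) ≤ p ^ (i +
  -- 1)`.
  have hanti : Antitone T := by
    refine antitone_nat_of_succ_le fun i => ?_
    simp only [hT, norm_div, norm_pow]
    rw [div_le_div_iff₀ (by positivity) (by positivity), pow_succ ‖(p : ℂ_[p])‖, ← hγp,
      mul_comm (_ ^ i), ← mul_assoc, ← pow_add]
    gcongr ?_ * _
    refine pow_le_pow_of_le_one hγ0.le hγ1.le ?_
    have h1 : 1 ≤ p ^ i := Nat.one_le_pow _ _ hp.pos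
    obtain ⟨p', rfl⟩ : ∃ p', p = p' + 1 := ⟨p - 1, by have := hp.pos; omega⟩
    rw [pow_succ, Nat.add_sub_cancel, mul_add, mul_one, add_comm]
    gcongr
    exact Nat.le_mul_of_pos_left _ h1
  have htail := (hasSum_nat_add_iff' (l + 1)).mpr hsum
  rw [zero_sub] at htail
  have hle : ‖gammaPartial γ l‖ ≤ T (l + 1) := by
    rw [gammaPartial, ← norm_neg, ← htail.tsum_eq]
    exact IsUltrametricDist.norm_tsum_le_of_forall_le_of_nonneg (norm_nonneg _)
      fun i => hanti (by omega : l + 1 ≤ i + (l + 1))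
  have hp' : p = (p - 1) + 1 := by have := hp.pos; omega
  rw [norm_mul, norm_pow]
  calc _ ≤ T (l + 1) * ‖(p : ℂ_[p])‖ ^ l * ‖γ‖ ^ p := by gcongr
    _ = T (l + 1) * ‖(p : ℂ_[p])‖ ^ (l + 1) * ‖γ‖ := by
      have hpow : ‖γ‖ ^ p = ‖(p : ℂ_[p])‖ * ‖γ‖ := by
        rw [← hγp, ← pow_succ, ← hp']
      rw [hpow]
      ring
    _ = _ := by
      simp only [hT, norm_div, norm_pow]
      rw [div_mul_cancel₀ _ (by positivity), ← pow_succ]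

/-- The exponent is `p ^ l` times `s` plus `p ^ l - 1` copies of `x_i`; adding one to both degrees
makes the relation multiplicative. -/
theorem coeff_hTerm (γ : ℂ_[p]) (τ : unramified p a ≃ₐ[ℚ_[p]] unramified p a)
    (fhat : MvPolynomial (Fin n) (unramified p a)) (i : Fin n) (l : ℕ) (v : Fin n →₀ ℕ) :
    (hTerm γ τ fhat i l).coeff v = 0 ∨ ∃ s : Fin n →₀ ℕ, v.degree + 1 = p ^ l * (s.degree + 1) ∧
      (hTerm γ τ fhat i l).coeff v = gammaPartial γ l * (p : ℂ_[p]) ^ l *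
        (((τ ^ l : unramified p a ≃ₐ[ℚ_[p]] unramified p a)
          ((MvPolynomial.pderiv i fhat).coeff s) : unramified p a) : ℂ_[p]) := by
  classical
  have hpl : p ^ l ≠ 0 := pow_ne_zero _ (Fact.out : p.Prime).ne_zero
  rw [or_iff_not_imp_left]
  intro h
  rw [hTerm, mul_assoc, MvPolynomial.coeff_C_mul, MvPolynomial.X_pow_eq_monomial,
    MvPolynomial.coeff_monomial_mul', one_mul] at h ⊢
  split_ifs at h ⊢ with hv
  · have hs := right_ne_zero_of_mul h
    rw [← MvPolynomial.mem_support_iff] at hs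
    obtain ⟨s, -, hs⟩ := Finset.mem_image.mp (MvPolynomial.support_expand_subset _ hs)
    refine ⟨s, ?_, ?_⟩
    · rw [← tsub_add_cancel_of_le hv, ← hs, map_add, Finsupp.degree_single, map_nsmul, smul_eq_mul,
        mul_add]
      omega
    · rw [← hs, MvPolynomial.coeff_expand_smul _ hpl, MvPolynomial.coeff_map,
        MvPolynomial.coeff_map]
      rfl
  · simp at h

theorem coeff_hTerm_zero (γ : ℂ_[p]) (τ : unramified p a ≃ₐ[ℚ_[p]] unramified p a)
    (fhat : MvPolynomial (Fin n) (unramified p a)) (i : Fin n) (v : Fin n →₀ ℕ) :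
    (hTerm γ τ fhat i 0).coeff v = γ * (((MvPolynomial.pderiv i fhat).coeff v : unramified p a) : ℂ_[p]) := by
  simp only [hTerm, gammaPartial, pow_zero, zero_add, Finset.sum_range_one, pow_one, div_one,
    mul_one, Nat.sub_self, MvPolynomial.expand_one_apply, MvPolynomial.coeff_C_mul,
    MvPolynomial.coeff_map]
  rfl

/-- A contributing term has `l < p ^ l ≤ |v| + 1`. -/
theorem coeff_hSeries (γ : ℂ_[p]) (τ : unramified p a ≃ₐ[ℚ_[p]] unramified p a)
    (fhat : MvPolynomial (Fin n) (unramified p a)) (i : Fin n) (v : Fin n →₀ ℕ) :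
    MvPowerSeries.coeff v (hSeries γ τ fhat i) =
      ∑ l ∈ Finset.range (v.degree + 1), (hTerm γ τ fhat i l).coeff v := by
  change ∑' l, _ = _
  refine tsum_eq_sum fun l hl => ?_
  rcases coeff_hTerm γ τ fhat i l v with h | ⟨s, hs, -⟩
  · exact h
  · rw [Finset.mem_range, not_lt] at hl
    have h1 := (Fact.out : p.Prime).one_lt
    have h2 := Nat.lt_pow_self h1 (n := l)
    have h3 := Nat.le_mul_of_pos_right (p ^ l) (s.degree.add_one_pos)
    omega

theorem coeff_hSeries_mem {Λ : Subfield ℂ_[p]} (hK : ∀ x : unramified p a, (x : ℂ_[p]) ∈ Λ)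
    {γ : ℂ_[p]} (hγ : γ ∈ Λ) (τ : unramified p a ≃ₐ[ℚ_[p]] unramified p a)
    (fhat : MvPolynomial (Fin n) (unramified p a)) (i : Fin n) (v : Fin n →₀ ℕ) :
    MvPowerSeries.coeff v (hSeries γ τ fhat i) ∈ Λ := by
  rw [coeff_hSeries]
  refine Λ.sum_mem fun l _ => ?_
  rcases coeff_hTerm γ τ fhat i l v with h | ⟨s, -, h⟩
  · rw [h]; exact Λ.zero_mem
  · rw [h]
    have hp : (p : ℂ_[p]) ∈ Λ := natCast_mem Λ p
    exact Λ.mul_mem (Λ.mul_mem (Λ.sum_mem fun j _ => Λ.div_mem (Λ.pow_mem hγ _) (Λ.pow_mem hp _))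
      (Λ.pow_mem hp _)) (hK _)

variable {Fq : Type*} [Field Fq] [Fintype Fq] {ρ : integers (unramified p a) →+* Fq}
  {f : MvPolynomial (Fin n) Fq} {fhat : MvPolynomial (Fin n) (unramified p a)}

/-- The estimate on the coefficients of the terms of `H_i`: the `l`-th term gains at least
`p ^ l - 1` over the leading term `γ ∂f̂^{(d)}/∂x_i`, and terms of lower degree gain too. -/
theorem norm_coeff_hTerm_le (hFq : Fintype.card Fq = p ^ a) (h : IsTeichmullerLift ρ f fhat)
    {γ : ℂ_[p]} (hsum : HasSum (fun i : ℕ => γ ^ p ^ i / (p : ℂ_[p]) ^ i) 0)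
    (hγ1 : ‖γ‖ < 1) (hγp : ‖γ‖ ^ (p - 1) = ‖(p : ℂ_[p])‖) {t : ℝ} (ht0 : 0 < t) (ht1 : t < 1)
    {m e d : ℕ} (hγt : ‖γ‖ = t ^ m) (hmp : e * (d + 1) < m * p) (hd : f.totalDegree = d + 1)
    (τ : unramified p a ≃ₐ[ℚ_[p]] unramified p a) (i : Fin n) (l : ℕ) (v : Fin n →₀ ℕ) :
    (hTerm γ τ fhat i l).coeff v = 0 ∨ (v.degree + 1 ≤ p ^ l * (d + 1) ∧
      ‖(hTerm γ τ fhat i l).coeff v‖ * t ^ (e * d) ≤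
        ‖γ‖ * t ^ (e * v.degree) * t ^ (p ^ l - 1 + e * (p ^ l * (d + 1) - (v.degree + 1)))) := by
  rcases coeff_hTerm γ τ fhat i l v with h0 | ⟨s, hs, hc⟩
  · exact Or.inl h0
  by_cases hsd : f.totalDegree < s.degree + 1
  · left
    rw [hc, h.coeff_pderiv_eq_zero hFq hsd, map_zero]
    simp
  right
  have hv : v.degree + 1 ≤ p ^ l * (d + 1) := by
    rw [hs]
    exact Nat.mul_le_mul_left _ (by omega)
  refine ⟨hv, ?_⟩
  have hle : ‖(hTerm γ τ fhat i l).coeff v‖ * ‖γ‖ ^ p ≤ ‖γ‖ ^ (p ^ (l + 1) + 1) := by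
    refine le_trans ?_ (norm_gammaPartial_mul_le hsum hγ1 hγp l)
    rw [hc, norm_mul]
    gcongr
    exact mul_le_of_le_one_right (norm_nonneg _) (h.norm_coeff_pderiv_le hFq (τ ^ l) i s)
  -- The factor `t ^ (m * p)` is `‖γ‖ ^ p` from the bound on `γ_l`, and `t ^ e` turns `e * d` into
  -- `e * (d + 1)`, so that `hmp` applies.
  have hmul : 0 < t ^ (m * p + e) := by positivity
  refine le_of_mul_le_mul_right ?_ hmul
  rw [hγt, ← pow_mul, ← pow_mul] at hle
  rw [hγt]
  calc _ = ‖(hTerm γ τ fhat i l).coeff v‖ * t ^ (m * p) * t ^ (e * (d + 1)) := by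
        rw [mul_add, mul_one, pow_add, pow_add]; ring
    _ ≤ t ^ (m * (p ^ (l + 1) + 1)) * t ^ (e * (d + 1)) := by gcongr
    _ ≤ _ := by
      simp only [← pow_add]
      refine pow_le_pow_of_le_one ht0.le ht1.le ?_
      obtain ⟨P, hP⟩ : ∃ P, p ^ l = P + 1 :=
        ⟨p ^ l - 1, by have := Nat.one_le_pow l p (Fact.out : p.Prime).pos; omega⟩
      obtain ⟨j, hj⟩ := Nat.exists_eq_add_of_le hv
      obtain ⟨k, hk⟩ := Nat.exists_eq_add_of_lt hmp
      -- The strict inequality `hmp` has slack `k + 1`. Multiplied by `p ^ l = P + 1`, it supplies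
      -- the gain `P`; the exponents then differ by `P * k`.
      have h1 : m * (p ^ (l + 1) + 1) = (P + 1) * (e * (d + 1) + k + 1) + m := by
        rw [← hk, pow_succ, hP]; ring
      have h2 : p ^ l * (d + 1) - (v.degree + 1) = j := by omega
      rw [hP] at hj
      have h3 : e * ((P + 1) * (d + 1)) = e * (v.degree + 1 + j) := by rw [hj]
      rw [h1, h2, hk, hP, Nat.add_sub_cancel]
      nlinarith [Nat.zero_le (P * k)]

/-- The leading form of `∂f̂/∂x_i`, of degree `d`. -/
def leadingPart (d : ℕ) (fhat : MvPolynomial (Fin n) (unramified p a)) (i : Fin n) :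
    MvPowerSeries (Fin n) ℂ_[p] :=
  fun v => if v.degree = d then (((MvPolynomial.pderiv i fhat).coeff v : unramified p a) : ℂ_[p])
    else 0

theorem coeff_leadingPart (d : ℕ) (fhat : MvPolynomial (Fin n) (unramified p a)) (i : Fin n)
    (v : Fin n →₀ ℕ) : MvPowerSeries.coeff v (leadingPart d fhat i) =
      if v.degree = d then (((MvPolynomial.pderiv i fhat).coeff v : unramified p a) : ℂ_[p])
      else 0 := rfl

/-- The term `l = 0` in degree `d` cancels against the leading part. Every other term gains a factor
`t`: from `p ^ l - 1` if `l > 0`, from the drop in degree if `l = 0`. -/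
theorem norm_coeff_sub_leadingPart_le (hFq : Fintype.card Fq = p ^ a)
    (h : IsTeichmullerLift ρ f fhat)
    {γ : ℂ_[p]} (hsum : HasSum (fun i : ℕ => γ ^ p ^ i / (p : ℂ_[p]) ^ i) 0)
    (hγ1 : ‖γ‖ < 1) (hγp : ‖γ‖ ^ (p - 1) = ‖(p : ℂ_[p])‖) {t : ℝ} (ht0 : 0 < t) (ht1 : t < 1)
    {m e d : ℕ} (he : 0 < e) (hγt : ‖γ‖ = t ^ m) (hmp : e * (d + 1) < m * p)
    (hd : f.totalDegree = d + 1)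
    (τ : unramified p a ≃ₐ[ℚ_[p]] unramified p a) (i : Fin n) (v : Fin n →₀ ℕ) :
    ‖MvPowerSeries.coeff v (γ⁻¹ • hSeries γ τ fhat i - leadingPart d fhat i)‖ * (t ^ e) ^ d ≤
      t * (t ^ e) ^ v.degree := by
  have hγ0 : 0 < ‖γ‖ := by rw [hγt]; positivity
  have hγne : γ ≠ 0 := norm_pos_iff.mp hγ0
  have key (l : ℕ) (hl : l ≠ 0 ∨ v.degree ≠ d) :
      ‖γ⁻¹ * (hTerm γ τ fhat i l).coeff v‖ ≤ t * t ^ (e * v.degree) / t ^ (e * d) := by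
    rcases norm_coeff_hTerm_le hFq h hsum hγ1 hγp ht0 ht1 hγt hmp hd τ i l v with h0 | ⟨hv, hle⟩
    · rw [h0, mul_zero, norm_zero]; positivity
    rw [le_div_iff₀ (by positivity), norm_mul, norm_inv, mul_assoc, inv_mul_le_iff₀ hγ0]
    refine hle.trans ?_
    rw [mul_assoc, mul_comm t]
    gcongr
    refine pow_le_of_le_one ht0.le ht1.le ?_
    have hp1 := (Fact.out : p.Prime).one_lt
    rcases eq_or_ne l 0 with rfl | hl0
    · have hvd := hl.resolve_left (by simp)
      rw [pow_zero, one_mul] at hv ⊢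
      exact (Nat.add_pos_right _ (Nat.mul_pos he (by omega))).ne'
    · have := Nat.one_lt_pow hl0 hp1
      omega
  rw [← pow_mul, ← pow_mul, ← le_div_iff₀ (by positivity), map_sub, MvPowerSeries.coeff_smul,
    coeff_hSeries, Finset.sum_range_succ', coeff_leadingPart, mul_add, Finset.mul_sum, add_sub_assoc]
  refine (IsUltrametricDist.norm_add_le_max _ _).trans (max_le ?_ ?_)
  · exact IsUltrametricDist.norm_sum_le_of_forall_le_of_nonneg (by positivity) fun l _ =>
      key (l + 1) (Or.inl l.succ_ne_zero)
  · split_ifs with hvd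
    · rw [coeff_hTerm_zero, inv_mul_cancel_left₀ hγne, sub_self, norm_zero]
      positivity
    · rw [sub_zero]
      exact key 0 (Or.inr hvd)

/-- A nonzero term at `v` has `p ^ l` larger than the quotient of `|v|` by `d + 1`, so the gain `p ^
l - 1` grows with `|v|`. -/
theorem coeffNull_hSeries (hFq : Fintype.card Fq = p ^ a)
    (h : IsTeichmullerLift ρ f fhat)
    {γ : ℂ_[p]} (hsum : HasSum (fun i : ℕ => γ ^ p ^ i / (p : ℂ_[p]) ^ i) 0)
    (hγ1 : ‖γ‖ < 1) (hγp : ‖γ‖ ^ (p - 1) = ‖(p : ℂ_[p])‖) {t : ℝ} (ht0 : 0 < t) (ht1 : t < 1)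
    {m e d : ℕ} (hγt : ‖γ‖ = t ^ m) (hmp : e * (d + 1) < m * p)
    (hd : f.totalDegree = d + 1)
    (τ : unramified p a ≃ₐ[ℚ_[p]] unramified p a) (i : Fin n) :
    CoeffNull (t ^ e) (hSeries γ τ fhat i) := by
  have htend : Filter.Tendsto (fun N : ℕ => ‖γ‖ / t ^ (e * d) * t ^ (N / (d + 1)))
      Filter.atTop (nhds 0) := by
    have := ((tendsto_pow_atTop_nhds_zero_of_lt_one ht0.le ht1).comp
      (Nat.tendsto_div_const_atTop d.succ_ne_zero)).const_mul (‖γ‖ / t ^ (e * d))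
    rwa [mul_zero] at this
  refine CoeffNull.of_tail (by positivity) htend fun v => ?_
  rw [coeff_hSeries]
  refine IsUltrametricDist.norm_sum_le_of_forall_le_of_nonneg (by positivity) fun l _ => ?_
  rcases norm_coeff_hTerm_le hFq h hsum hγ1 hγp ht0 ht1 hγt hmp hd τ i l v with h0 | ⟨hv, hle⟩
  · rw [h0, norm_zero]; positivity
  rw [← le_div_iff₀ (by positivity)] at hle
  refine hle.trans ?_
  rw [← pow_mul]
  calc _ ≤ ‖γ‖ * t ^ (e * v.degree) * t ^ (v.degree / (d + 1)) / t ^ (e * d) := by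
        gcongr ?_ / _
        gcongr _ * ?_
        refine pow_le_pow_of_le_one ht0.le ht1.le ?_
        have : v.degree / (d + 1) < p ^ l := by
          rw [Nat.div_lt_iff_lt_mul d.succ_pos]; exact hv
        omega
    _ = _ := by ring

end Coefficients

/-! ### Finiteness and completeness of `K(ζ, π)` -/

section Fields

variable {p : ℕ} [Fact p.Prime]

instance finiteDimensional_unramified (a : ℕ) [NeZero a] :
    FiniteDimensional ℚ_[p] (unramified p a) := by
  have hq : 1 < p ^ a := Nat.one_lt_pow (NeZero.ne a) (Fact.out : p.Prime).one_lt
  have hmonic (F : Type) [Field F] : (Polynomial.X ^ p ^ a - Polynomial.X : Polynomial F).Monic :=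
    Polynomial.monic_X_pow_sub (by rw [Polynomial.degree_X]; exact_mod_cast hq)
  have hfin : {x : ℂ_[p] | x ^ p ^ a = x}.Finite := by
    refine (Polynomial.finite_setOfPred_isRoot (hmonic ℂ_[p]).ne_zero).subset fun x hx => ?_
    simp [Polynomial.IsRoot, show x ^ p ^ a = x from hx]
  have := hfin.to_subtype
  exact IntermediateField.finiteDimensional_adjoin fun x (hx : x ^ p ^ a = x) =>
    ⟨_, hmonic ℚ_[p], by simp [hx]⟩

theorem finiteDimensional_bigField (a : ℕ) [NeZero a] {ζ π : ℂ_[p]} (hζ : IsIntegral ℚ_[p] ζ)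
    (hπ : IsIntegral ℚ_[p] π) : FiniteDimensional ℚ_[p] (bigField p a ζ π) := by
  have : FiniteDimensional ℚ_[p] (IntermediateField.adjoin ℚ_[p] {ζ, π}) :=
    IntermediateField.finiteDimensional_adjoin fun x hx => by
      rcases hx with rfl | rfl
      exacts [hζ, hπ]
  exact IntermediateField.finiteDimensional_sup _ _

theorem completeSpace_toSubfield (L : IntermediateField ℚ_[p] ℂ_[p]) [FiniteDimensional ℚ_[p] L] :
    CompleteSpace L.toSubfield :=
  FiniteDimensional.complete ℚ_[p] L

end Fields

/-! ### `C(b)` and its filtration in terms of norms -/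

section Spaces

variable {p : ℕ} [Fact p.Prime] {n : ℕ} {L : IntermediateField ℚ_[p] ℂ_[p]} {π : ℂ_[p]} {e : ℕ}

theorem mem_spaceC_iff (hπL : π ∈ L) (hR : 0 < ‖π ^ e‖) (ξ : MvPowerSeries (Fin n) ℂ_[p]) :
    ξ ∈ spaceC n L π e ↔ ξ ∈ nullSeries n L.toSubfield hR := by
  have hne : π ^ e ≠ 0 := norm_pos_iff.mp hR
  constructor
  · rintro ⟨A, hA, hA0, h⟩
    refine ⟨fun u => by rw [h]; exact L.mul_mem (hA u) (pow_mem hπL _), ?_⟩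
    rw [coeffNull_iff_tendsto hR]
    refine (tendsto_zero_iff_norm_tendsto_zero.mp hA0).congr fun u => ?_
    rw [h, pow_mul, norm_mul, norm_pow (π ^ e), mul_div_cancel_right₀ _ (by positivity)]
  · rintro ⟨h, h0⟩
    refine ⟨fun u => MvPowerSeries.coeff u ξ / (π ^ e) ^ u.degree,
      fun u => L.div_mem (h u) (pow_mem (pow_mem hπL _) _), ?_, fun u => ?_⟩
    · rw [tendsto_zero_iff_norm_tendsto_zero]
      refine ((coeffNull_iff_tendsto hR ξ).mp h0).congr fun u => ?_
      rw [norm_div, norm_pow (π ^ e)]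
    · rw [pow_mul, div_mul_cancel₀ _ (pow_ne_zero _ hne)]

/-- The coefficients and `π` already lie in `L`, so integrality of the quotient is purely a norm
condition. -/
theorem mem_filC_iff (hπL : π ∈ L) (hπ0 : π ≠ 0) (r : ℤ) (ξ : MvPowerSeries (Fin n) ℂ_[p]) :
    ξ ∈ filC n L π e r ↔ ξ ∈ spaceC n L π e ∧ CoeffBound ‖π ^ e‖ (‖π‖ ^ r) ξ := by
  refine and_congr_right fun hξ => forall_congr' fun u => ?_
  have hπn : 0 < ‖π‖ := norm_pos_iff.mpr hπ0
  rw [← norm_pow, ← pow_mul, ← norm_zpow, ← norm_mul]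
  constructor
  · rintro ⟨o, ho⟩
    rw [ho, mul_right_comm, norm_mul]
    exact mul_le_of_le_one_right (norm_nonneg _) o.2
  · intro h
    have hne : π ^ r * π ^ (e * u.degree) ≠ 0 :=
      mul_ne_zero (zpow_ne_zero _ hπ0) (pow_ne_zero _ hπ0)
    have hL : MvPowerSeries.coeff u ξ ∈ L := by
      obtain ⟨A, hA, -, hξ⟩ := hξ
      rw [hξ]
      exact L.mul_mem (hA u) (pow_mem hπL _)
    refine ⟨⟨⟨MvPowerSeries.coeff u ξ / (π ^ r * π ^ (e * u.degree)),
      L.div_mem hL (L.mul_mem (zpow_mem hπL r) (pow_mem hπL _))⟩, ?_⟩, ?_⟩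
    · change ‖MvPowerSeries.coeff u ξ / (π ^ r * π ^ (e * u.degree))‖ ≤ 1
      rw [norm_div]
      exact div_le_one_of_le₀ h (norm_nonneg _)
    · change _ = π ^ r * (MvPowerSeries.coeff u ξ / (π ^ r * π ^ (e * u.degree))) * _
      rw [mul_right_comm, mul_div_cancel₀ _ hne]

end Spaces

/-! ### The spanning hypothesis as a congruence of polynomials -/

section Span

variable {k : Type*} [Field k] {n : ℕ}

/-- If the classes of the monomials `x^{μ_j}` span the top cohomology, then every monomial is a
combination of them modulo the ideal generated by the `g_i`. -/
theorem exists_monomial_eq_of_span_eq_top (g : Fin n → MvPolynomial (Fin n) k) {ι : Type*}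
    [Fintype ι] (μ : ι → (Fin n →₀ ℕ))
    (hspan : Submodule.span k (Set.range fun j => topClass (fun i => LinearMap.mulLeft k (g i)) ⊤
      (topForm ⊤ (MvPolynomial.monomial (μ j) (1 : k)) Submodule.mem_top)) = ⊤)
    (u : Fin n →₀ ℕ) :
    ∃ (a : ι → k) (h : Fin n → MvPolynomial (Fin n) k),
      MvPolynomial.monomial u 1 = ∑ j, MvPolynomial.monomial (μ j) (a j) + ∑ i, g i * h i := by
  set φ : Fin n → MvPolynomial (Fin n) k →ₗ[k] MvPolynomial (Fin n) k :=
    fun i => LinearMap.mulLeft k (g i)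
  set F : MvPolynomial (Fin n) k → kForms n (⊤ : Submodule k (MvPolynomial (Fin n) k)) n :=
    fun ξ => topForm ⊤ ξ Submodule.mem_top
  have hmem : topClass φ ⊤ (F (MvPolynomial.monomial u 1)) ∈
      Submodule.span k (Set.range fun j => topClass φ ⊤ (F (MvPolynomial.monomial (μ j) 1))) := by
    rw [hspan]
    exact Submodule.mem_top
  obtain ⟨a, ha⟩ := (Submodule.mem_span_range_iff_exists_fun k).mp hmem
  have h0 : topClass φ ⊤ (F (MvPolynomial.monomial u 1) -
      ∑ j, a j • F (MvPolynomial.monomial (μ j) 1)) = 0 := by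
    rw [map_sub, map_sum, sub_eq_zero, ← ha]
    simp only [map_smul]
  obtain ⟨h, -, hh⟩ := (topClass_eq_zero_iff _ _ _).mp h0
  refine ⟨a, h, ?_⟩
  have hF (ξ) : (F ξ).1 Finset.univ = ξ := by simp [F, topForm]
  have hval : (F (MvPolynomial.monomial u 1) -
      ∑ j, a j • F (MvPolynomial.monomial (μ j) 1)).1 Finset.univ =
      MvPolynomial.monomial u 1 - ∑ j, MvPolynomial.monomial (μ j) (a j) := by
    simp [hF, Finset.sum_apply, MvPolynomial.smul_monomial]
  rw [hval, sub_eq_iff_eq_add'] at hh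
  exact hh

end Span

/-! ### Lifting the congruence to characteristic zero -/

section Kernel

variable {p : ℕ} [Fact p.Prime] {a n : ℕ} {Fq : Type*} [Field Fq] [Fintype Fq]
  {ρ : integers (unramified p a) →+* Fq} {f : MvPolynomial (Fin n) Fq}
  {fhat : MvPolynomial (Fin n) (unramified p a)}

/-- Lifting a congruence in `Fq[x]` along Teichmüller representatives: in each homogeneous degree,
a monomial is, up to elements of norm `≤ ‖p‖`, the same combination of the `x^{μ_j}` and the leading
parts of the `∂f̂/∂x_i`. -/
theorem norm_coeff_lift_le (hFq : Fintype.card Fq = p ^ a) (hf : IsTeichmullerLift ρ f fhat)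
    {d : ℕ} {ι : Type*} [Fintype ι] (μ : ι → (Fin n →₀ ℕ)) {T : Fq → integers (unramified p a)}
    (hT : ∀ c, T c ^ p ^ a = T c) (hTρ : ∀ c, ρ (T c) = c)
    {u : Fin n →₀ ℕ} {b : ι → Fq} {h : Fin n → MvPolynomial (Fin n) Fq}
    (hu : MvPolynomial.monomial u 1 = ∑ j, MvPolynomial.monomial (μ j) (b j) +
      ∑ i, MvPolynomial.pderiv i (MvPolynomial.homogeneousComponent (d + 1) f) * h i)
    (v : Fin n →₀ ℕ) :
    ‖MvPowerSeries.coeff v (MvPowerSeries.monomial u (1 : ℂ_[p]) -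
        ∑ j, MvPowerSeries.monomial (μ j) ((T (b j) : unramified p a) : ℂ_[p])) -
      ∑ i, ∑ x ∈ Finset.HasAntidiagonal.antidiagonal v,
        MvPowerSeries.coeff x.1 (leadingPart d fhat i) *
          ((T ((h i).coeff x.2) : unramified p a) : ℂ_[p])‖ ≤ ‖(p : ℂ_[p])‖ := by
  classical
  choose G hG hGf hGρ using hf.exists_coeff_pderiv
  have hTmem (c) : T c ∈ teichmullerRing p a := Subring.subset_closure (hT c)
  -- The error coefficient, formed inside the Teichmüller ring: it reduces to zero by `hu`, and
  -- there that forces norm at most `‖p‖`.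
  let κ : integers (unramified p a) :=
    (if v = u then 1 else 0) - ∑ j, (if v = μ j then T (b j) else 0) -
      ∑ i, ∑ x ∈ Finset.HasAntidiagonal.antidiagonal v,
        (if x.1.degree = d then G i x.1 else 0) * T ((h i).coeff x.2)
  have hκmem : κ ∈ teichmullerRing p a := by
    refine sub_mem (sub_mem ?_ (sum_mem fun j _ => ?_))
      (sum_mem fun i _ => sum_mem fun x _ => mul_mem ?_ (hTmem _))
    · split_ifs
      exacts [one_mem _, zero_mem _]
    · split_ifs
      exacts [hTmem _, zero_mem _]
    · split_ifs
      exacts [hG _ _, zero_mem _]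
  have hcomp (i : Fin n) (s : Fin n →₀ ℕ) :
      (MvPolynomial.pderiv i (MvPolynomial.homogeneousComponent (d + 1) f)).coeff s =
        if s.degree = d then (MvPolynomial.pderiv i f).coeff s else 0 := by
    rw [MvPolynomial.coeff_pderiv, MvPolynomial.coeff_pderiv,
      MvPolynomial.coeff_homogeneousComponent, map_add, Finsupp.degree_single]
    simp only [Nat.add_right_cancel_iff, ite_mul, zero_mul]
  have hmonomial (m : Fin n →₀ ℕ) (c : Fq) :
      (MvPolynomial.monomial m c).coeff v = if v = m then c else 0 := by
    rw [MvPolynomial.coeff_monomial]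
    exact if_congr eq_comm rfl rfl
  have hκρ : ρ κ = 0 := by
    have := congrArg (MvPolynomial.coeff v) hu
    simp only [MvPolynomial.coeff_add, MvPolynomial.coeff_sum, MvPolynomial.coeff_mul,
      hmonomial, hcomp] at this
    simp only [κ, map_sub, map_sum, map_mul, apply_ite ρ, map_one, map_zero, hTρ, hGρ]
    rw [sub_sub, sub_eq_zero]
    exact this
  refine le_of_eq_of_le (congrArg norm ?_) (norm_le_of_mem_teichmullerRing hFq ρ hκmem hκρ)
  have hcoe : ∀ x : integers (unramified p a), ((x : unramified p a) : ℂ_[p]) =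
      ((algebraMap (unramified p a) ℂ_[p]).comp (integers (unramified p a)).subtype) x := fun _ => rfl
  simp only [coeff_leadingPart, ← hGf, hcoe, κ, map_sub, map_sum, map_mul, MvPowerSeries.coeff_monomial,
    apply_ite ((algebraMap (unramified p a) ℂ_[p]).comp (integers (unramified p a)).subtype),
    map_one, map_zero]

end Kernel

end DworkAffine

end

/-! ### Assembly: numerical parameters and the contraction constant -/

theorem proposition3p11
    -- the field of `q = p ^ a` elements as the residue field of `K`, with reduction map `ρ`
    (p : ℕ) [Fact p.Prime] (a : ℕ)
    {Fq : Type*} [Field Fq] [Fintype Fq] (hFq : Fintype.card Fq = p ^ a)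
    (ρ : DworkAffine.integers (DworkAffine.unramified p a) →+* Fq)
    -- `τ` is the Frobenius automorphism of `K`
    (τ : DworkAffine.unramified p a ≃ₐ[ℚ_[p]] DworkAffine.unramified p a)
    (hτ : ∀ x y : DworkAffine.integers (DworkAffine.unramified p a),
      τ (x : DworkAffine.unramified p a) = y → ρ y = ρ x ^ p)
    -- the polynomial `f` of degree `d` and its Teichmüller lifting
    (n d : ℕ) (f : MvPolynomial (Fin n) Fq) (hd : f.totalDegree = d)
    (fhat : MvPolynomial (Fin n) (DworkAffine.unramified p a))
    (hfhat : DworkAffine.IsTeichmullerLift ρ f fhat)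
    -- `ζ` is a primitive `p`-th root of unity and `γ ∈ ℚ_p(ζ)` the parameter with `ord γ = 1/(p-1)`
    (ζ : ℂ_[p]) (hζ : IsPrimitiveRoot ζ p)
    (γ : ℂ_[p]) (hγ_mem : γ ∈ IntermediateField.adjoin ℚ_[p] {ζ})
    (hγ_sum : HasSum (fun i : ℕ => γ ^ p ^ i / (p : ℂ_[p]) ^ i) 0)
    (hγ_ord : ‖γ‖ = (p : ℝ) ^ (-(1 / ((p : ℝ) - 1))))
    -- the parameters `b` and `M`; the integers `k = M b / p` and `m = M d / (p - 1)`
    (b : ℚ) (hb_lower : 1 / ((p : ℚ) - 1) < b) (hb_upper : b < p / ((p : ℚ) - 1))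
    (M : ℕ) (hM : 0 < M)
    (k m : ℕ) (hk : (M : ℚ) * b / p = k) (hm : (M : ℚ) * d / ((p : ℚ) - 1) = m)
    (π : ℂ_[p]) (hπ : π ^ (M * d) = p)
    -- `L = K(ζ, π)`, `e = M b`, `ε = M b (d - 1) - M d / (p - 1)`, and the operators `π^ε D_i`
    (L : IntermediateField ℚ_[p] ℂ_[p]) (hL : L = DworkAffine.bigField p a ζ π)
    (e : ℕ) (he : e = p * k) (ε : ℤ) (hε : ε = (e : ℤ) * ((d : ℤ) - 1) - m)
    (D : Fin n → MvPowerSeries (Fin n) ℂ_[p] →ₗ[L] MvPowerSeries (Fin n) ℂ_[p])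
    (hD : D = DworkAffine.scaledD L π ε γ τ fhat)
    -- the partial derivatives of the leading form of `f`, and multiplication by them
    (g : Fin n → MvPolynomial (Fin n) Fq)
    (hg : g = fun i => MvPolynomial.pderiv i (MvPolynomial.homogeneousComponent d f))
    (φ : Fin n → MvPolynomial (Fin n) Fq →ₗ[Fq] MvPolynomial (Fin n) Fq)
    (hφ : φ = fun i => LinearMap.mulLeft Fq (g i))
    (hreg : RingTheory.Sequence.IsRegular (MvPolynomial (Fin n) Fq) (List.ofFn g))
    -- monomials whose classes form a basis of `H^n` of the complex of forms over `Fq[x]` with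
    -- differential `ω ↦ df^{(d)} ∧ ω`
    (μ : Fin ((d - 1) ^ n) → (Fin n →₀ ℕ))
    (hμ_indep : LinearIndependent Fq fun i => DworkAffine.topClass φ ⊤
      (DworkAffine.topForm ⊤ (MvPolynomial.monomial (μ i) (1 : Fq)) Submodule.mem_top))
    (hμ_span : Submodule.span Fq (Set.range fun i => DworkAffine.topClass φ ⊤
      (DworkAffine.topForm ⊤ (MvPolynomial.monomial (μ i) (1 : Fq)) Submodule.mem_top)) = ⊤)
    (r : ℤ) (η : DworkAffine.kForms n (DworkAffine.spaceC n L π e) n)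
    (hη : η ∈ DworkAffine.filForms n L π e r n) :
    ∃ (c : Fin ((d - 1) ^ n) → L)
      (hc : ∀ i, MvPowerSeries.monomial (μ i) (c i : ℂ_[p]) ∈ DworkAffine.filC n L π e r),
      DworkAffine.topClass D (DworkAffine.spaceC n L π e) η =
        ∑ i, DworkAffine.topClass D (DworkAffine.spaceC n L π e)
          (DworkAffine.topForm _ (MvPowerSeries.monomial (μ i) (c i : ℂ_[p])) (hc i).1) := by
  have hp : p.Prime := Fact.out
  have hp1 : (1 : ℚ) < p := by exact_mod_cast hp.one_lt
  have hp1' : (0 : ℚ) < p - 1 := by linarith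
  have hq : 1 < p ^ a := hFq ▸ Fintype.one_lt_card
  have : NeZero a := ⟨by rintro rfl; simp at hq⟩
  have hpC : (p : ℂ_[p]) ≠ 0 := Nat.cast_ne_zero.mpr hp.ne_zero
  have hMd0 : M * d ≠ 0 := by
    intro h
    rw [h, pow_zero] at hπ
    have := DworkAffine.norm_prime_lt_one p
    rw [← hπ, norm_one] at this
    exact this.false
  -- `d = 0` would give `p = 1` in `ℂ_p`; `s = d - 1` is the degree of the leading parts of the
  -- derivatives.
  obtain ⟨s, rfl⟩ : ∃ s, d = s + 1 := Nat.exists_eq_succ_of_ne_zero (right_ne_zero_of_mul hMd0)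
  have hMq : (0 : ℚ) < M := by exact_mod_cast hM
  have heb : (e : ℚ) = M * b := by
    rw [he, Nat.cast_mul, ← hk]
    field_simp
  have hb0 : 0 < b := lt_trans (by positivity) hb_lower
  have he0 : 0 < e := by
    have : (0 : ℚ) < e := by rw [heb]; positivity
    exact_mod_cast this
  have hsq : (0 : ℚ) < (s + 1 : ℕ) := by positivity
  have hm' : (m : ℚ) * (p - 1) = M * (s + 1 : ℕ) := by rw [← hm]; field_simp
  have hmNat : m * (p - 1) = M * (s + 1) := by
    have h : ((p - 1 : ℕ) : ℚ) = p - 1 := by rw [Nat.cast_sub hp.one_le, Nat.cast_one]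
    exact_mod_cast h ▸ hm'
  -- The upper bound on `b`, multiplied by `M d`; it controls the terms of `H_i`.
  have hmp : e * (s + 1) < m * p := by
    have h1 : b * (p - 1) < p := (lt_div_iff₀ hp1').mp hb_upper
    have : ((e * (s + 1) : ℕ) : ℚ) < (m * p : ℕ) := by
      rw [Nat.cast_mul, Nat.cast_mul, heb]
      refine lt_of_mul_lt_mul_right ?_ hp1'.le
      calc (M * b * (s + 1 : ℕ) * (p - 1) : ℚ) = M * (s + 1 : ℕ) * (b * (p - 1)) := by ring
        _ < M * (s + 1 : ℕ) * p := by gcongr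
        _ = _ := by rw [← hm']; ring
    exact_mod_cast this
  -- The lower bound on `b`, multiplied by `M d`; it makes `γ⁻¹ ∂_i` contract.
  have hme : m < e * (s + 1) := by
    have h1 : 1 < b * (p - 1) := (div_lt_iff₀ hp1').mp hb_lower
    have : (m : ℚ) < (e * (s + 1) : ℕ) := by
      rw [Nat.cast_mul, heb]
      refine lt_of_mul_lt_mul_right ?_ hp1'.le
      calc (m * (p - 1) : ℚ) = M * (s + 1 : ℕ) * 1 := by rw [hm', mul_one]
        _ < M * (s + 1 : ℕ) * (b * (p - 1)) := by gcongr
        _ = _ := by ring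
    exact_mod_cast this
  have hπ0 : π ≠ 0 := by
    rintro rfl
    rw [zero_pow hMd0] at hπ
    exact hpC hπ.symm
  have ht0 : 0 < ‖π‖ := norm_pos_iff.mpr hπ0
  have hπp : ‖π‖ ^ (M * (s + 1)) = ‖(p : ℂ_[p])‖ := by rw [← norm_pow, hπ]
  have ht1 : ‖π‖ < 1 := by
    by_contra! h
    have := one_le_pow₀ h (n := M * (s + 1))
    rw [hπp] at this
    exact (DworkAffine.norm_prime_lt_one p).not_ge this
  have hpt : ‖(p : ℂ_[p])‖ ≤ ‖π‖ := hπp ▸ pow_le_of_le_one ht0.le ht1.le hMd0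
  have hγp : ‖γ‖ ^ (p - 1) = ‖(p : ℂ_[p])‖ := by
    have hpR : (0 : ℝ) ≤ p := Nat.cast_nonneg p
    have hpR1 : (p : ℝ) - 1 ≠ 0 := by
      have : (1 : ℝ) < p := by exact_mod_cast hp.one_lt
      linarith
    rw [hγ_ord, DworkAffine.norm_prime, ← Real.rpow_natCast, ← Real.rpow_mul hpR,
      Nat.cast_sub hp.one_le, Nat.cast_one, neg_mul, one_div, inv_mul_cancel₀ hpR1,
      Real.rpow_neg_one]
  have hγt : ‖γ‖ = ‖π‖ ^ m := by
    refine (pow_left_inj₀ (norm_nonneg γ) (by positivity) (n := p - 1)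
      (by have := hp.one_lt; omega)).mp ?_
    rw [hγp, ← pow_mul, hmNat, hπp]
  have hγ1 : ‖γ‖ < 1 := by
    by_contra! h
    have := one_le_pow₀ h (n := p - 1)
    rw [hγp] at this
    exact (DworkAffine.norm_prime_lt_one p).not_ge this
  have hγ0 : γ ≠ 0 := norm_pos_iff.mp (by rw [hγt]; positivity)
  have hadj : IntermediateField.adjoin ℚ_[p] {ζ, π} ≤ L := hL ▸ le_sup_right
  have hKL : DworkAffine.unramified p a ≤ L := hL ▸ le_sup_left
  have hπL : π ∈ L := hadj (IntermediateField.subset_adjoin _ _ (by simp))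
  have hγL : γ ∈ L :=
    hadj (IntermediateField.adjoin.mono _ _ _ (Set.singleton_subset_iff.mpr (by simp)) hγ_mem)
  have hfin : FiniteDimensional ℚ_[p] L := by
    rw [hL]
    refine DworkAffine.finiteDimensional_bigField a (IsIntegral.of_pow hp.pos ?_)
      (IsIntegral.of_pow (Nat.pos_of_ne_zero hMd0) ?_)
    · rw [hζ.pow_eq_one]
      exact isIntegral_one
    · rw [hπ]
      exact isIntegral_natCast p
  have hcompl := DworkAffine.completeSpace_toSubfield L
  have hR : 0 < ‖π ^ e‖ := norm_pos_iff.mpr (pow_ne_zero _ hπ0)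
  subst hφ hg
  have hspan := DworkAffine.exists_monomial_eq_of_span_eq_top _ μ hμ_span
  choose A h hAh using hspan
  choose T hT hTρ using DworkAffine.exists_teichmuller hFq ρ
  obtain ⟨hηC, hηB⟩ := (DworkAffine.mem_filC_iff hπL hπ0 r _).mp (hη Finset.univ)
  have hKL' (x : DworkAffine.unramified p a) : (x : ℂ_[p]) ∈ L.toSubfield := hKL x.2
  -- The contraction constant is `θ = ‖π‖`: the two bounds on `b` are strict inequalities between
  -- integers after clearing denominators, so each gains at least one power of `π`.
  obtain ⟨c, ω, hc, hω, hηω⟩ := DworkAffine.exists_reduction (Λ := L.toSubfield) (ϖ := π ^ e)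
    (pow_mem hπL _) hR ht0.le ht1 (s := s) (c₀ := γ⁻¹) (L.inv_mem hγL)
    (by
      rw [norm_inv, hγt, norm_pow, ← pow_mul, inv_mul_le_iff₀ (by positivity), ← pow_succ]
      exact pow_le_pow_of_le_one ht0.le ht1.le hme)
    (Q := fun i => γ⁻¹ • DworkAffine.hSeries γ τ fhat i)
    (G := DworkAffine.leadingPart s fhat)
    (fun i v hv => by
      rw [DworkAffine.coeff_leadingPart] at hv
      exact (ite_ne_right_iff.mp hv).1)
    (fun i => DworkAffine.smul_mem_nullSeries (L.inv_mem hγL)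
      ⟨DworkAffine.coeff_hSeries_mem hKL' hγL τ fhat i, by
        rw [norm_pow]
        exact DworkAffine.coeffNull_hSeries hFq hfhat hγ_sum hγ1 hγp ht0 ht1 hγt hmp hd τ i⟩)
    (fun i v => by
      rw [norm_pow]
      exact DworkAffine.norm_coeff_sub_leadingPart_le hFq hfhat hγ_sum hγ1 hγp ht0 ht1 he0 hγt hmp
        hd τ i v)
    μ (fun u j => ((T (A u j) : DworkAffine.unramified p a) : ℂ_[p])) (fun u j => hKL' _)
    (fun u j => (T (A u j)).2)
    (fun i u v => ((T ((h u i).coeff v) : DworkAffine.unramified p a) : ℂ_[p]))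
    (fun i u v => hKL' _) (fun i u v => (T ((h u i).coeff v)).2)
    (fun u v _ => (DworkAffine.norm_coeff_lift_le hFq hfhat μ hT hTρ (hAh u) v).trans hpt)
    ((DworkAffine.mem_spaceC_iff hπL hR _).mp hηC) (zpow_nonneg ht0.le r) hηB
  have hmono (i) : MvPowerSeries.monomial (μ i) (c i) ∈ DworkAffine.filC n L π e r := by
    classical
    rw [DworkAffine.mem_filC_iff hπL hπ0, DworkAffine.mem_spaceC_iff hπL hR]
    refine ⟨DworkAffine.monomial_mem_nullSeries (hc i).1 _, fun u => ?_⟩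
    rw [MvPowerSeries.coeff_monomial]
    split_ifs with hu
    · rw [hu]; exact (hc i).2
    · rw [norm_zero]; positivity
  refine ⟨fun i => ⟨c i, (hc i).1⟩, hmono, ?_⟩
  rw [← map_sum, ← sub_eq_zero, ← map_sub, DworkAffine.topClass_eq_zero_iff]
  -- The reduction used `γ⁻¹ D_i`, while the complex uses `π^ε D_i`; this scalar converts the
  -- primitives.
  have hscal : γ⁻¹ * π ^ (-ε) ∈ L.toSubfield := L.mul_mem (L.inv_mem hγL) (zpow_mem hπL _)
  refine ⟨fun i => (γ⁻¹ * π ^ (-ε)) • ω i, fun i => (DworkAffine.mem_spaceC_iff hπL hR _).mpr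
    (DworkAffine.smul_mem_nullSeries hscal (hω i)), ?_⟩
  have hval : (η - ∑ i, DworkAffine.topForm (DworkAffine.spaceC n L π e)
      (MvPowerSeries.monomial (μ i) (c i)) (hmono i).1).1 Finset.univ =
      η.1 Finset.univ - ∑ i, MvPowerSeries.monomial (μ i) (c i) := by
    simp [DworkAffine.topForm, Finset.sum_apply]
  refine hval.trans ?_
  rw [hηω, add_sub_cancel_left, hD]
  refine Finset.sum_congr rfl fun i _ => ?_
  have hDi (ξ : MvPowerSeries (Fin n) ℂ_[p]) : DworkAffine.scaledD L π ε γ τ fhat i ξ =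
      π ^ ε • (MvPowerSeries.pderiv ℂ_[p] i ξ + DworkAffine.hSeries γ τ fhat i * ξ) := rfl
  rw [hDi, Derivation.map_smul, mul_smul_comm, ← smul_add, smul_smul, zpow_neg,
    mul_comm γ⁻¹, mul_inv_cancel_left₀ (zpow_ne_zero _ hπ0), smul_add, smul_mul_assoc]
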